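/- Let $\Omega\subset\mathbb C^n$ be open and let $\Phi:\Omega\to\mathbb R$ be a smooth Kähler potential, i.e. the matrix of $g_{i\bar j}=\partial_i\partial_{\bar j}\Phi$ is positive definite on $\Omega$; let $g^{i\bar j}$ be the inverse metric. Let $\Phi(x,y)$ be an almost analytic extension of $\Phi$ to a neighbourhood of the diagonal: it is smooth, $\Phi(x,x)=\Phi(x)$, $\overline{\Phi(x,y)}=\Phi(y,x)$, and $\bar\partial_x\Phi(x,y)$ and $\partial_y\Phi(x,y)$ vanish to infinite order at $x=y$. Let $D(x,y)=\Phi(x)+\Phi(y)-\Phi(x,y)-\Phi(y,x)$ be Calabi's diastatic function, and put $$S(x,y)=\sum_{i,j}g_{i\bar j}(x)(y_i-x_i)\overline{(y_j-x_j)}-D(x,y),\qquad Lf(y)=\sum_{i,j}g^{i\bar j}(x)\,\partial_i\partial_{\bar j}f(y).$$ Engliš's operators are $$R_kf(x)=\frac1{\det g(x)}\sum_{m=k}^{3k}\frac1{m!\,(m-k)!}\,L^m\bigl(f\,\det g\,S(x,\cdot)^{m-k}\bigr)\Big|_{y=x},$$ and his scalar invariants are $r_k=R_k(1)$. A digraph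 $G=(V,E)$ is finite and may have loops and multiple edges; $A(G)$ is its adjacency matrix, and $\mathrm{Aut}(G)$ is the group of its automorphisms (compatible pairs of a permutation of $V$ and a permutation of $E$, so that permutations of parallel edges count). $G$ is stable if every vertex has indegree and outdegree at least $2$; its weight is $|E|-|V|$. Let $\mathcal G(k)$ be the set of isomorphism classes of stable digraphs of weight $k$; it is finite. The Weyl invariant of $G$, also denoted $G$, is obtained by giving each edge an unbarred index at its tail and a barred index at its head, putting at each vertex the derivative $\partial_{i_1\cdots i_p}\partial_{\bar j_1\cdots\bar j_q}\Phi$ (a derivative of $g_{i_1\bar j_1}$) in the indices of its outgoing half-edges $i_1,\dots,i_p$ and its incoming half-edges $\bar j_1,\dots,\bar j_q$, and contracting the two indices of every edge by $g^{i\bar j}$. Then $r_0=1$ on $\Omega$. Moreover, let $k\ge1$ and let $x\in\Omega$ be the centre of a normal coordinate system of some order $N\ge k$, i.e. $g_{i\bar j}(x)=\delta_{ij}$ and $\partial_{l_1}\cdots\partial_{l_r}g_{i\bar j}(x)=\partial_{\bar l_1}\cdots\partial_{\bar l_r}g_{i\bar j}(x)=0$ for $1\le r\le N$ and all indices. Then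 $$r_k(x)=\sum_{G\in\mathcal G(k)}\frac{\det(A(G)-I)}{|\mathrm{Aut}(G)|}\,G\,(x).$$ -/

import Mathlib

open scoped ContDiff ComplexOrder

noncomputable section

namespace BerezinGraph

/-! ### Wirtinger derivatives -/

section Wirtinger

variable {E : Type*} [NormedAddCommGroup E] [NormedSpace ℝ E] [NormedSpace ℂ E]
  [IsScalarTower ℝ ℂ E]

/-- The holomorphic Wirtinger derivative in the direction `v`:
`½ (D f (v) - √-1 D f (√-1 v))`, where `D f` is the real derivative. -/
def wirt (v : E) (f : E → ℂ) (p : E) : ℂ :=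
  (1 / 2) * (fderiv ℝ f p v - Complex.I * fderiv ℝ f p (Complex.I • v))

/-- The antiholomorphic Wirtinger derivative in the direction `v`:
`½ (D f (v) + √-1 D f (√-1 v))`. -/
def wirtBar (v : E) (f : E → ℂ) (p : E) : ℂ :=
  (1 / 2) * (fderiv ℝ f p v + Complex.I * fderiv ℝ f p (Complex.I • v))

end Wirtinger

variable {n : ℕ}

/-- `∂ f / ∂ z_i` on `ℂⁿ`. -/
def dz (i : Fin n) (f : (Fin n → ℂ) → ℂ) : (Fin n → ℂ) → ℂ :=
  wirt (Pi.single i 1) f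

/-- `∂ f / ∂ \bar z_i` on `ℂⁿ`. -/
def dzBar (i : Fin n) (f : (Fin n → ℂ) → ℂ) : (Fin n → ℂ) → ℂ :=
  wirtBar (Pi.single i 1) f

/-- The iterated derivative `∂^α` for a multi-index `α`. -/
def dzMulti (α : Fin n → ℕ) (f : (Fin n → ℂ) → ℂ) : (Fin n → ℂ) → ℂ :=
  (List.finRange n).foldr (fun i F => (dz i)^[α i] F) f

/-- The iterated derivative `\bar∂^β` for a multi-index `β`. -/
def dzBarMulti (β : Fin n → ℕ) (f : (Fin n → ℂ) → ℂ) : (Fin n → ℂ) → ℂ :=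
  (List.finRange n).foldr (fun i F => (dzBar i)^[β i] F) f

/-! ### Kähler metrics given by a potential -/

/-- The metric `g_{i \bar j} = ∂_i ∂_{\bar j} Φ` of a potential `Φ`. -/
def metric (Φ : (Fin n → ℂ) → ℝ) (z : Fin n → ℂ) : Matrix (Fin n) (Fin n) ℂ :=
  Matrix.of fun i j => dz i (dzBar j fun w => (Φ w : ℂ)) z

/-- The inverse metric `g^{i \bar j}`, normalised by
`∑_j g^{i \bar j} g_{k \bar j} = δ_{ik}`. -/
def invMetric (Φ : (Fin n → ℂ) → ℝ) (z : Fin n → ℂ) (i j : Fin n) : ℂ :=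
  (metric Φ z)⁻¹ j i

/-- `Φ` is a (smooth) Kähler potential on the open set `Ω ⊆ ℂⁿ`. -/
structure IsKahlerPotential (Ω : Set (Fin n → ℂ)) (Φ : (Fin n → ℂ) → ℝ) : Prop where
  isOpen : IsOpen Ω
  smooth : ContDiffOn ℝ ∞ Φ Ω
  posDef : ∀ z ∈ Ω, (metric Φ z).PosDef

/-- The coordinates are normal at `x` to order `N`: `g_{i \bar j}(x) = δ_{ij}`, and all purely
holomorphic and all purely antiholomorphic derivatives of `g_{i \bar j}` of orders
`1, …, N` vanish at `x`. -/
structure IsNormalAt (Φ : (Fin n → ℂ) → ℝ) (x : Fin n → ℂ) (N : ℕ) : Prop where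
  metric_eq : metric Φ x = 1
  holo : ∀ (i j : Fin n) (α : Fin n → ℕ), 1 ≤ ∑ l, α l → ∑ l, α l ≤ N →
    dzMulti α (fun z => metric Φ z i j) x = 0
  antiholo : ∀ (i j : Fin n) (β : Fin n → ℕ), 1 ≤ ∑ l, β l → ∑ l, β l ≤ N →
    dzBarMulti β (fun z => metric Φ z i j) x = 0

/-- `Ψ (x, y)` is an almost analytic extension of `Φ` to a neighbourhood `U` of the diagonal of
`Ω`: `Ψ (z, z) = Φ z`, the derivatives `\bar∂_x Ψ` and `∂_y Ψ` vanish to infinite order on the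
diagonal, and `Ψ` is Hermitian symmetric. -/
structure IsAlmostAnalyticExtension (Ω : Set (Fin n → ℂ)) (Φ : (Fin n → ℂ) → ℝ)
    (U : Set ((Fin n → ℂ) × (Fin n → ℂ))) (Ψ : (Fin n → ℂ) × (Fin n → ℂ) → ℂ) : Prop where
  isOpen : IsOpen U
  diag_mem : ∀ z ∈ Ω, (z, z) ∈ U
  smooth : ContDiffOn ℝ ∞ Ψ U
  diag_eq : ∀ z ∈ Ω, Ψ (z, z) = (Φ z : ℂ)
  dbar_fst : ∀ z ∈ Ω, ∀ (i : Fin n) (m : ℕ),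
    iteratedFDeriv ℝ m (wirtBar ((Pi.single i 1, 0) : (Fin n → ℂ) × (Fin n → ℂ)) Ψ) (z, z) = 0
  d_snd : ∀ z ∈ Ω, ∀ (i : Fin n) (m : ℕ),
    iteratedFDeriv ℝ m (wirt ((0, Pi.single i 1) : (Fin n → ℂ) × (Fin n → ℂ)) Ψ) (z, z) = 0
  symm : ∀ p ∈ U, p.swap ∈ U ∧ starRingEnd ℂ (Ψ p) = Ψ p.swap

/-! ### The operators `R_k` -/

/-- Calabi's diastatic function `D(x, y) = Φ(x) + Φ(y) - Φ(x, y) - Φ(y, x)`. -/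
def diastasis (Φ : (Fin n → ℂ) → ℝ) (Ψ : (Fin n → ℂ) × (Fin n → ℂ) → ℂ)
    (x y : Fin n → ℂ) : ℂ :=
  (Φ x : ℂ) + (Φ y : ℂ) - Ψ (x, y) - Ψ (y, x)

/-- The function `S(x, y)`, i.e. minus the part of order at least three of the diastatic
function: `D(x, y) = ∑ g_{i \bar j}(x) (y - x)_i \overline{(y - x)_j} - S(x, y)`. -/
def phaseRemainder (Φ : (Fin n → ℂ) → ℝ) (Ψ : (Fin n → ℂ) × (Fin n → ℂ) → ℂ)
    (x y : Fin n → ℂ) : ℂ :=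
  (∑ i, ∑ j, metric Φ x i j * (y i - x i) * starRingEnd ℂ (y j - x j)) - diastasis Φ Ψ x y

/-- The operator `L = ∑ g^{i \bar j}(x) ∂_i ∂_{\bar j}`, with coefficients frozen at `x`. -/
def frozenLaplacian (Φ : (Fin n → ℂ) → ℝ) (x : Fin n → ℂ) (f : (Fin n → ℂ) → ℂ) :
    (Fin n → ℂ) → ℂ :=
  fun y => ∑ i, ∑ j, invMetric Φ x i j * dz i (dzBar j f) y

/-- Engliš's operators
`R_k f(x) = (det g(x))⁻¹ ∑_{m=k}^{3k} 1 / (m! (m-k)!) · L^m (f det g S(x, ·)^{m-k}) |_{y=x}`. -/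
def englisR (Φ : (Fin n → ℂ) → ℝ) (Ψ : (Fin n → ℂ) × (Fin n → ℂ) → ℂ) (k : ℕ)
    (f : (Fin n → ℂ) → ℂ) (x : Fin n → ℂ) : ℂ :=
  (1 / (metric Φ x).det) * ∑ m ∈ Finset.Icc k (3 * k),
    (1 / ((m.factorial : ℂ) * ((m - k).factorial : ℂ))) *
      (frozenLaplacian Φ x)^[m]
        (fun y => f y * (metric Φ y).det * phaseRemainder Φ Ψ x y ^ (m - k)) x

/-- The scalar invariant `r_k = R_k(1)`. -/
def scalarInvariant (Φ : (Fin n → ℂ) → ℝ) (Ψ : (Fin n → ℂ) × (Fin n → ℂ) → ℂ) (k : ℕ)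
    (x : Fin n → ℂ) : ℂ :=
  englisR Φ Ψ k (fun _ => 1) x

/-! ### Stable digraphs -/

/-- A finite digraph, loops and multiple edges being allowed, with vertices and edges numbered.
Every finite digraph is isomorphic to one of these. -/
structure MultiDigraph where
  nV : ℕ
  nE : ℕ
  src : Fin nE → Fin nV
  tgt : Fin nE → Fin nV

namespace MultiDigraph

/-- An isomorphism of digraphs: compatible bijections of the vertices and of the edges. -/
@[ext]
structure Iso (G H : MultiDigraph) where
  onV : Fin G.nV ≃ Fin H.nV
  onE : Fin G.nE ≃ Fin H.nE
  src_comm : ∀ e, H.src (onE e) = onV (G.src e)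
  tgt_comm : ∀ e, H.tgt (onE e) = onV (G.tgt e)

/-- The identity isomorphism. -/
def Iso.refl (G : MultiDigraph) : Iso G G :=
  ⟨Equiv.refl _, Equiv.refl _, fun _ => rfl, fun _ => rfl⟩

/-- The inverse of an isomorphism. -/
def Iso.symm {G H : MultiDigraph} (φ : Iso G H) : Iso H G where
  onV := φ.onV.symm
  onE := φ.onE.symm
  src_comm e := by rw [Equiv.eq_symm_apply, ← φ.src_comm, Equiv.apply_symm_apply]
  tgt_comm e := by rw [Equiv.eq_symm_apply, ← φ.tgt_comm, Equiv.apply_symm_apply]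

/-- The composition of two isomorphisms. -/
def Iso.trans {G H K : MultiDigraph} (φ : Iso G H) (ψ : Iso H K) : Iso G K where
  onV := φ.onV.trans ψ.onV
  onE := φ.onE.trans ψ.onE
  src_comm e := by simp [φ.src_comm, ψ.src_comm]
  tgt_comm e := by simp [φ.tgt_comm, ψ.tgt_comm]

/-- The automorphisms of `G`. Parallel edges are distinguishable, so that permuting them
is an automorphism. -/
abbrev Aut (G : MultiDigraph) : Type := Iso G G

/-- The adjacency matrix: `A_{ij}` is the number of edges from `i` to `j`. -/
def adj (G : MultiDigraph) : Matrix (Fin G.nV) (Fin G.nV) ℚ :=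
  Matrix.of fun i j => ((Finset.univ.filter fun e => G.src e = i ∧ G.tgt e = j).card : ℚ)

/-- The outdegree of a vertex. -/
def outDeg (G : MultiDigraph) (v : Fin G.nV) : ℕ :=
  (Finset.univ.filter fun e => G.src e = v).card

/-- The indegree of a vertex. -/
def inDeg (G : MultiDigraph) (v : Fin G.nV) : ℕ :=
  (Finset.univ.filter fun e => G.tgt e = v).card

/-- A digraph is stable if all its indegrees and outdegrees are at least two. -/
def Stable (G : MultiDigraph) : Prop := ∀ v, 2 ≤ G.inDeg v ∧ 2 ≤ G.outDeg v

/-- The weight `|E| - |V|`. -/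
def weight (G : MultiDigraph) : ℤ := (G.nE : ℤ) - (G.nV : ℤ)

/-- The coefficient `det (A(G) - I) / |Aut G|`. -/
def coeff (G : MultiDigraph) : ℚ := (G.adj - 1).det / (Nat.card G.Aut : ℚ)

/-- The multi-index of the holomorphic derivatives at the vertex `v`, when the outgoing half of
each edge `e` carries the index `a e`. -/
def outIndex (G : MultiDigraph) (a : Fin G.nE → Fin n) (v : Fin G.nV) : Fin n → ℕ :=
  fun i => (Finset.univ.filter fun e => G.src e = v ∧ a e = i).card

/-- The multi-index of the antiholomorphic derivatives at the vertex `v`, when the incoming half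
of each edge `e` carries the index `b e`. -/
def inIndex (G : MultiDigraph) (b : Fin G.nE → Fin n) (v : Fin G.nV) : Fin n → ℕ :=
  fun i => (Finset.univ.filter fun e => G.tgt e = v ∧ b e = i).card

/-- The value at `x`, in the given coordinates, of the Weyl invariant represented by `G`. A vertex
with outgoing half-edges `i_1, …, i_p` and incoming half-edges `\bar j_1, …, \bar j_q` stands for
the derivative `g_{i_1 \bar j_1 i_2 … i_p \bar j_2 … \bar j_q} = ∂_{i_1 … i_p} ∂_{\bar j_1 … \bar
j_q} Φ` of the metric, and each edge stands for the contraction of its two indices with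
`g^{i \bar j}`. -/
def weylValue (G : MultiDigraph) (Φ : (Fin n → ℂ) → ℝ) (x : Fin n → ℂ) : ℂ :=
  ∑ a : Fin G.nE → Fin n, ∑ b : Fin G.nE → Fin n,
    (∏ e, invMetric Φ x (a e) (b e)) *
      ∏ v, dzMulti (G.outIndex a v) (dzBarMulti (G.inIndex b v) fun w => (Φ w : ℂ)) x

theorem Iso.adj_eq {G H : MultiDigraph} (φ : Iso G H) :
    G.adj = H.adj.submatrix φ.onV φ.onV := by
  ext i j
  simp only [adj, Matrix.of_apply, Matrix.submatrix_apply]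
  congr 1
  refine Finset.card_equiv φ.onE fun e => ?_
  simp [φ.src_comm, φ.tgt_comm]

theorem Iso.coeff_eq {G H : MultiDigraph} (φ : Iso G H) : G.coeff = H.coeff := by
  have h1 : (G.adj - 1).det = (H.adj - 1).det := by
    rw [← Matrix.det_submatrix_equiv_self φ.onV (H.adj - 1), φ.adj_eq]
    congr 1
    ext i j
    simp [Matrix.one_apply]
  have h2 : Nat.card G.Aut = Nat.card H.Aut := by
    refine Nat.card_congr ⟨fun ψ => (φ.symm.trans ψ).trans φ,
      fun ψ => (φ.trans ψ).trans φ.symm, fun ψ => ?_, fun ψ => ?_⟩ <;>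
    · ext e <;> simp [Iso.trans, Iso.symm]
  rw [coeff, coeff, h1, h2]

theorem Iso.weylValue_eq {G H : MultiDigraph} (φ : Iso G H) (Φ : (Fin n → ℂ) → ℝ)
    (x : Fin n → ℂ) : G.weylValue Φ x = H.weylValue Φ x := by
  unfold weylValue
  refine Fintype.sum_equiv (φ.onE.arrowCongr (Equiv.refl _)) _ _ fun a => ?_
  refine Fintype.sum_equiv (φ.onE.arrowCongr (Equiv.refl _)) _ _ fun b => ?_
  congr 1
  · refine Fintype.prod_equiv φ.onE _ _ fun e => ?_
    simp
  · refine Fintype.prod_equiv φ.onV _ _ fun v => ?_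
    have h1 : G.outIndex a v = H.outIndex (φ.onE.arrowCongr (Equiv.refl _) a) (φ.onV v) := by
      funext i
      refine Finset.card_equiv φ.onE fun e => ?_
      simp [φ.src_comm]
    have h2 : G.inIndex b v = H.inIndex (φ.onE.arrowCongr (Equiv.refl _) b) (φ.onV v) := by
      funext i
      refine Finset.card_equiv φ.onE fun e => ?_
      simp [φ.tgt_comm]
    rw [h1, h2]

theorem Stable.two_mul_le {G : MultiDigraph} (hG : G.Stable) : 2 * G.nV ≤ G.nE := by
  have h := Finset.card_eq_sum_card_fiberwise (f := G.src) (s := Finset.univ)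
    (t := Finset.univ) (fun _ _ => Finset.mem_univ _)
  have h' : ∑ _v : Fin G.nV, 2 ≤ ∑ v : Fin G.nV, G.outDeg v :=
    Finset.sum_le_sum fun v _ => (hG v).2
  simp only [Finset.sum_const, Finset.card_univ, Fintype.card_fin, smul_eq_mul] at h h'
  have : G.nE = ∑ v : Fin G.nV, G.outDeg v := h
  omega

end MultiDigraph

/-- The stable digraphs of weight `k`. -/
def StableDigraph (k : ℕ) : Type := {G : MultiDigraph // G.Stable ∧ G.weight = k}

instance (k : ℕ) : Finite (StableDigraph k) := by
  let T := Σ p : Fin (k + 1) × Fin (2 * k + 1),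
    (Fin p.2 → Fin p.1) × (Fin p.2 → Fin p.1)
  have hb : ∀ G : StableDigraph k, G.1.nV < k + 1 ∧ G.1.nE < 2 * k + 1 := fun G => by
    have h1 := G.2.1.two_mul_le
    have h2 := G.2.2
    unfold MultiDigraph.weight at h2
    omega
  let f : StableDigraph k → T := fun G =>
    ⟨(⟨G.1.nV, (hb G).1⟩, ⟨G.1.nE, (hb G).2⟩), (G.1.src, G.1.tgt)⟩
  let g : T → MultiDigraph := fun t => ⟨t.1.1, t.1.2, t.2.1, t.2.2⟩
  exact Finite.of_injective f fun G H h => Subtype.ext (congrArg g h)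

/-- Isomorphism of stable digraphs of weight `k`. -/
instance isoSetoid (k : ℕ) : Setoid (StableDigraph k) where
  r G H := Nonempty (MultiDigraph.Iso G.1 H.1)
  iseqv :=
    { refl := fun G => ⟨MultiDigraph.Iso.refl G.1⟩
      symm := fun ⟨φ⟩ => ⟨φ.symm⟩
      trans := fun ⟨φ⟩ ⟨ψ⟩ => ⟨φ.trans ψ⟩ }

/-- The set `𝒢(k)` of stable digraphs of weight `k`, up to isomorphism. -/
def StableClass (k : ℕ) : Type := Quotient (isoSetoid k)

instance (k : ℕ) : Finite (StableClass k) :=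
  inferInstanceAs (Finite (Quotient (isoSetoid k)))

instance (k : ℕ) : Fintype (StableClass k) := Fintype.ofFinite _

/-- The coefficient `det (A(G) - I) / |Aut G|` of an isomorphism class. -/
def StableClass.coeff {k : ℕ} (c : StableClass k) : ℚ :=
  Quotient.lift (fun G : StableDigraph k => G.1.coeff) (fun _ _ h => Nonempty.elim h fun φ => φ.coeff_eq) c

/-- The value at `x` of the Weyl invariant represented by an isomorphism class. -/
def StableClass.weylValue {k : ℕ} (c : StableClass k) (Φ : (Fin n → ℂ) → ℝ)
    (x : Fin n → ℂ) : ℂ :=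
  Quotient.lift (fun G : StableDigraph k => G.1.weylValue Φ x)
    (fun _ _ h => Nonempty.elim h fun φ => φ.weylValue_eq Φ x) c

end BerezinGraph

end

open BerezinGraph

/-! Both sides are the same signed sum of contractions over digraphs in which a set of edges forming
a permutation is singled out. Write `g = 1 + h`. Near `x` everything lives in the algebra of smooth
functions, where `∂_i` and `∂̄_i` are commuting derivations; since `g(x) = 1`, `L` is `∑ ∂_i ∂̄_i`
at the centre. By the iterated Leibniz rule (`flatLaplacian_iterate_prod`), `L^m` of a product is a
sum over all ways of drawing `m` labelled edges between the factors. Expanding `det (1 + h)` into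
principal minors, and these over permutations `σ`, gives products of `s` entries of `h` and `l`
factors `S`. An entry of `h` is a derivative of `Φ` that already has one outgoing and one incoming
half-edge, so the entries contribute the extra edges `σ a → a`. A factor `S` acts as minus a vertex.
With `m = k + l` the digraph has `s + l` vertices and `s + l + k` edges, hence weight `k`
(`JetData.sum_eval`). On the graph side, `det (A - I)` is expanded into principal minors too. Each
term of a minor of `A` selects edges `σ a → a`, and counting the choices of vertices and edges gives
the same coefficients (`sum_det_mul_contraction`). Dividing by `|Aut G|` amounts to summing over
numbered digraphs and dividing by `|V|! |E|!` (`card_isoClass_mul_card_aut`). Normality enters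
through the jets (`NormalJets.jetData`): up to the orders that occur, `h` and `S` only see `∂^α ∂̄^β
Φ` with `|α|, |β| ≥ 2`. This is why only stable digraphs survive. -/

open TopologicalSpace

noncomputable section

set_option linter.unusedSectionVars false

namespace BerezinGraph

/-! ### Smooth functions on an open set, Wirtinger derivations, flatness and pullbacks. -/

section SmoothAlgebra

variable {E : Type*} [NormedAddCommGroup E] [NormedSpace ℝ E]

/-- Extension of a function on an open set by zero. -/
def zeroExt (O : Opens E) (f : O → ℂ) : E → ℂ := Function.extend Subtype.val f 0

theorem zeroExt_apply {O : Opens E} (f : O → ℂ) (p : O) : zeroExt O f p = f p :=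
  Subtype.val_injective.extend_apply f 0 p

theorem zeroExt_eqOn {O : Opens E} {f : O → ℂ} {F : E → ℂ} (h : ∀ p : O, f p = F p) :
    Set.EqOn (zeroExt O f) F O := fun p hp => (zeroExt_apply f ⟨p, hp⟩).trans (h ⟨p, hp⟩)

/-- The algebra of smooth complex functions on an open set. -/
def smoothAlg (O : Opens E) : Subalgebra ℂ (O → ℂ) where
  carrier := {f | ContDiffOn ℝ ∞ (zeroExt O f) O}
  mul_mem' {f g} hf hg :=
    (ContDiffOn.mul hf hg).congr (zeroExt_eqOn fun p => by simp [zeroExt_apply])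
  add_mem' {f g} hf hg :=
    (ContDiffOn.add hf hg).congr (zeroExt_eqOn fun p => by simp [zeroExt_apply])
  algebraMap_mem' r :=
    (contDiffOn_const (c := r)).congr (zeroExt_eqOn fun p => by simp)

variable {O : Opens E}

/-- The function `F` restricts to the element `a` of the algebra of smooth functions. -/
def Rep (a : smoothAlg O) (F : E → ℂ) : Prop := ∀ p : O, a.1 p = F p

theorem rep_zeroExt (a : smoothAlg O) : Rep a (zeroExt O a.1) := fun p => (zeroExt_apply _ p).symm

theorem exists_rep {F : E → ℂ} (hF : ContDiffOn ℝ ∞ F O) : ∃ a : smoothAlg O, Rep a F :=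
  ⟨⟨fun p => F p, hF.congr (zeroExt_eqOn fun _ => rfl)⟩, fun _ => rfl⟩

theorem Rep.contDiffOn {a : smoothAlg O} {F : E → ℂ} (h : Rep a F) : ContDiffOn ℝ ∞ F O :=
  ContDiffOn.congr a.2 (zeroExt_eqOn h).symm

theorem Rep.contDiffAt {a : smoothAlg O} {F : E → ℂ} (h : Rep a F) (p : O) :
    ContDiffAt ℝ ∞ F p := h.contDiffOn.contDiffAt (O.isOpen.mem_nhds p.2)

theorem Rep.differentiableAt {a : smoothAlg O} {F : E → ℂ} (h : Rep a F) (p : O) :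
    DifferentiableAt ℝ F p := (h.contDiffAt p).differentiableAt (by simp)

theorem Rep.eventuallyEq {a : smoothAlg O} {F G : E → ℂ} (hF : Rep a F) (hG : Rep a G) (p : O) :
    F =ᶠ[nhds (p : E)] G := by
  filter_upwards [O.isOpen.mem_nhds p.2] with q hq
  exact (hF ⟨q, hq⟩).symm.trans (hG ⟨q, hq⟩)

theorem Rep.add {a b : smoothAlg O} {F G : E → ℂ} (hF : Rep a F) (hG : Rep b G) :
    Rep (a + b) (fun z => F z + G z) := fun p => congrArg₂ (· + ·) (hF p) (hG p)

theorem Rep.sub {a b : smoothAlg O} {F G : E → ℂ} (hF : Rep a F) (hG : Rep b G) :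
    Rep (a - b) (fun z => F z - G z) := fun p => congrArg₂ (· - ·) (hF p) (hG p)

theorem Rep.mul {a b : smoothAlg O} {F G : E → ℂ} (hF : Rep a F) (hG : Rep b G) :
    Rep (a * b) (fun z => F z * G z) := fun p => congrArg₂ (· * ·) (hF p) (hG p)

theorem Rep.smul {a : smoothAlg O} {F : E → ℂ} (c : ℂ) (hF : Rep a F) :
    Rep (c • a) (fun z => c * F z) := fun p => congrArg (c * ·) (hF p)

theorem Rep.pow {a : smoothAlg O} {F : E → ℂ} (hF : Rep a F) (m : ℕ) :
    Rep (a ^ m) (fun z => F z ^ m) := fun p => congrArg (· ^ m) (hF p)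

theorem rep_const (c : ℂ) : Rep (algebraMap ℂ (smoothAlg O) c) (fun _ => c) := fun _ => rfl

/-- Evaluation at a point, as an algebra homomorphism. -/
def evalHom (p : O) : smoothAlg O →ₐ[ℂ] ℂ := (Pi.evalAlgHom ℂ (fun _ : O => ℂ) p).comp
  (smoothAlg O).val

theorem evalHom_apply (p : O) (a : smoothAlg O) : evalHom p a = a.1 p := rfl

theorem Rep.evalHom {a : smoothAlg O} {F : E → ℂ} (h : Rep a F) (p : O) :
    evalHom p a = F p := h p

theorem smoothAlg_ext {a b : smoothAlg O} (h : ∀ p, evalHom p a = evalHom p b) : a = b :=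
  Subtype.ext (funext h)

theorem Rep.sum {ι : Type*} {s : Finset ι} {a : ι → smoothAlg O} {F : ι → E → ℂ}
    (h : ∀ i ∈ s, Rep (a i) (F i)) : Rep (∑ i ∈ s, a i) (fun z => ∑ i ∈ s, F i z) := fun p => by
  rw [← evalHom_apply, map_sum]
  exact Finset.sum_congr rfl fun i hi => h i hi p

/-- The directional derivative, as a derivation of the algebra of smooth functions. -/
def dirD (O : Opens E) (v : E) : Derivation ℂ (smoothAlg O) (smoothAlg O) :=
  Derivation.mk'
    { toFun := fun a => ⟨fun p => fderiv ℝ (zeroExt O a.1) p v,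
        ((a.2.fderiv_of_isOpen O.isOpen (m := ∞) (by simp)).clm_apply
          contDiffOn_const).congr (zeroExt_eqOn fun _ => rfl)⟩
      map_add' := fun a b => Subtype.ext <| funext fun p => by
        have h := (rep_zeroExt (a + b)).eventuallyEq ((rep_zeroExt a).add (rep_zeroExt b)) p
        change fderiv ℝ (zeroExt O (a + b).1) p v = _
        rw [h.fderiv_eq, fderiv_fun_add ((rep_zeroExt a).differentiableAt p)
          ((rep_zeroExt b).differentiableAt p)]
        rfl
      map_smul' := fun c a => Subtype.ext <| funext fun p => by
        have h := (rep_zeroExt (c • a)).eventuallyEq ((rep_zeroExt a).smul c) p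
        change fderiv ℝ (zeroExt O (c • a).1) p v = _
        rw [h.fderiv_eq, fderiv_const_mul ((rep_zeroExt a).differentiableAt p)]
        rfl }
    fun a b => Subtype.ext <| funext fun p => by
      have h := (rep_zeroExt (a * b)).eventuallyEq ((rep_zeroExt a).mul (rep_zeroExt b)) p
      change fderiv ℝ (zeroExt O (a * b).1) p v = _
      rw [h.fderiv_eq, fderiv_fun_mul ((rep_zeroExt a).differentiableAt p)
        ((rep_zeroExt b).differentiableAt p), zeroExt_apply, zeroExt_apply]
      rfl

theorem Rep.dirD {a : smoothAlg O} {F : E → ℂ} (h : Rep a F) (v : E) :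
    Rep (dirD O v a) (fun z => fderiv ℝ F z v) := fun p => by
  change fderiv ℝ (zeroExt O a.1) p v = _
  rw [((rep_zeroExt a).eventuallyEq h p).fderiv_eq]

theorem dirD_comm (v w : E) (a : smoothAlg O) :
    dirD O v (dirD O w a) = dirD O w (dirD O v a) := by
  refine smoothAlg_ext fun p => ?_
  have hr := rep_zeroExt a
  have hd : DifferentiableAt ℝ (fderiv ℝ (zeroExt O a.1)) p :=
    ((hr.contDiffAt p).fderiv_right (m := ∞) (by simp)).differentiableAt (by simp)
  rw [((hr.dirD w).dirD v).evalHom, ((hr.dirD v).dirD w).evalHom, fderiv_clm_apply hd (by fun_prop),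
    fderiv_clm_apply hd (by fun_prop)]
  simpa using (hr.contDiffAt p).isSymmSndFDerivAt
    (by rw [minSmoothness_of_isRCLikeNormedField]; exact WithTop.coe_le_coe.2 le_top) v w

theorem dirD_add (v w : E) (a : smoothAlg O) :
    dirD O (v + w) a = dirD O v a + dirD O w a := by
  refine smoothAlg_ext fun p => ?_
  have hr := rep_zeroExt a
  rw [map_add, (hr.dirD _).evalHom, (hr.dirD _).evalHom, (hr.dirD _).evalHom, map_add]

variable [NormedSpace ℂ E]

/-- The holomorphic Wirtinger derivative, as a derivation. -/
def wirtD (O : Opens E) (v : E) : Derivation ℂ (smoothAlg O) (smoothAlg O) :=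
  (1 / 2 : ℂ) • (dirD O v - Complex.I • dirD O (Complex.I • v))

/-- The antiholomorphic Wirtinger derivative, as a derivation. -/
def wirtBarD (O : Opens E) (v : E) : Derivation ℂ (smoothAlg O) (smoothAlg O) :=
  (1 / 2 : ℂ) • (dirD O v + Complex.I • dirD O (Complex.I • v))

theorem wirtD_apply (v : E) (a : smoothAlg O) :
    wirtD O v a = (1 / 2 : ℂ) • (dirD O v a - Complex.I • dirD O (Complex.I • v) a) := rfl

theorem wirtBarD_apply (v : E) (a : smoothAlg O) :
    wirtBarD O v a = (1 / 2 : ℂ) • (dirD O v a + Complex.I • dirD O (Complex.I • v) a) := rfl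

theorem Rep.wirtD {a : smoothAlg O} {F : E → ℂ} (h : Rep a F) (v : E) [IsScalarTower ℝ ℂ E] :
    Rep (wirtD O v a) (wirt v F) := ((h.dirD _).sub ((h.dirD _).smul _)).smul _

theorem Rep.wirtBarD {a : smoothAlg O} {F : E → ℂ} (h : Rep a F) (v : E) [IsScalarTower ℝ ℂ E] :
    Rep (wirtBarD O v a) (wirtBar v F) := ((h.dirD _).add ((h.dirD _).smul _)).smul _

theorem wirtD_comm (v w : E) (a : smoothAlg O) :
    wirtD O v (wirtD O w a) = wirtD O w (wirtD O v a) := by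
  simp only [wirtD_apply, Derivation.map_smul, Derivation.map_sub]
  rw [dirD_comm v w, dirD_comm v, dirD_comm _ w, dirD_comm (Complex.I • v)]
  module

theorem wirtBarD_comm (v w : E) (a : smoothAlg O) :
    wirtBarD O v (wirtBarD O w a) = wirtBarD O w (wirtBarD O v a) := by
  simp only [wirtBarD_apply, Derivation.map_smul, Derivation.map_add]
  rw [dirD_comm v w, dirD_comm v, dirD_comm _ w, dirD_comm (Complex.I • v)]
  module

theorem wirtD_wirtBarD_comm (v w : E) (a : smoothAlg O) :
    wirtD O v (wirtBarD O w a) = wirtBarD O w (wirtD O v a) := by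
  simp only [wirtD_apply, wirtBarD_apply, Derivation.map_smul, Derivation.map_add, Derivation.map_sub]
  rw [dirD_comm v w, dirD_comm v, dirD_comm _ w, dirD_comm (Complex.I • v)]
  module

theorem wirtD_add (v w : E) (a : smoothAlg O) :
    wirtD O (v + w) a = wirtD O v a + wirtD O w a := by
  simp only [wirtD_apply, smul_add, dirD_add]
  module

theorem wirtBarD_add (v w : E) (a : smoothAlg O) :
    wirtBarD O (v + w) a = wirtBarD O v a + wirtBarD O w a := by
  simp only [wirtBarD_apply, smul_add, dirD_add]
  module

/-- All derivatives of `a` at `p`, including the value, vanish. -/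
def Flat (p : O) (a : smoothAlg O) : Prop := ∀ m, iteratedFDeriv ℝ m (zeroExt O a.1) p = 0

theorem Rep.flat_iff {a : smoothAlg O} {F : E → ℂ} (h : Rep a F) (p : O) :
    Flat p a ↔ ∀ m, iteratedFDeriv ℝ m F p = 0 :=
  forall_congr' fun m => by
    rw [(((rep_zeroExt a).eventuallyEq h p).iteratedFDeriv ℝ m).self_of_nhds]

theorem Flat.eval {p : O} {a : smoothAlg O} (h : Flat p a) : evalHom p a = 0 := by
  have h0 := congrArg (fun T => T fun _ => 0) (h 0)
  rw [evalHom_apply]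
  simpa [zeroExt_apply] using h0

theorem Flat.add {p : O} {a b : smoothAlg O} (ha : Flat p a) (hb : Flat p b) : Flat p (a + b) := by
  rw [((rep_zeroExt a).add (rep_zeroExt b)).flat_iff]
  intro m
  have := iteratedFDeriv_add_apply (i := m) (((rep_zeroExt a).contDiffAt p).of_le (by exact_mod_cast le_top))
    (((rep_zeroExt b).contDiffAt p).of_le (by exact_mod_cast le_top))
  refine Eq.trans this ?_
  rw [ha m, hb m, add_zero]

theorem Flat.smul {p : O} {a : smoothAlg O} (c : ℂ) (ha : Flat p a) : Flat p (c • a) := by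
  rw [((rep_zeroExt a).smul c).flat_iff]
  intro m
  have := ((ContinuousLinearMap.mul ℝ ℂ) c).iteratedFDeriv_comp_left
    (((rep_zeroExt a).contDiffAt p)) (i := m) (by exact_mod_cast le_top)
  refine Eq.trans this ?_
  rw [ha m]
  ext; simp

theorem Flat.dirD {p : O} {a : smoothAlg O} (ha : Flat p a) (v : E) : Flat p (dirD O v a) := by
  rw [((rep_zeroExt a).dirD v).flat_iff]
  intro m
  have := (ContinuousLinearMap.apply ℝ ℂ v).iteratedFDeriv_comp_left
    (((rep_zeroExt a).contDiffAt p).fderiv_right (m := ∞) (by simp)) (i := m)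
    (by exact_mod_cast le_top)
  refine Eq.trans this ?_
  have h0 : iteratedFDeriv ℝ m (fderiv ℝ (zeroExt O a.1)) p = 0 := by
    rw [← norm_eq_zero, norm_iteratedFDeriv_fderiv, ha (m + 1), norm_zero]
  rw [h0]
  ext; simp

theorem Flat.wirtD {p : O} {a : smoothAlg O} (ha : Flat p a) (v : E) : Flat p (wirtD O v a) := by
  rw [wirtD_apply, sub_eq_add_neg, ← neg_smul]
  exact ((ha.dirD _).add ((ha.dirD _).smul _)).smul _

theorem Flat.wirtBarD {p : O} {a : smoothAlg O} (ha : Flat p a) (v : E) :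
    Flat p (wirtBarD O v a) := by
  rw [wirtBarD_apply]
  exact ((ha.dirD _).add ((ha.dirD _).smul _)).smul _

/-- `a` is the pullback of `b` along `ι`. -/
def IsPullback {E' : Type*} [NormedAddCommGroup E'] [NormedSpace ℝ E'] {O' : Opens E'}
    (ι : E → E') (a : smoothAlg O) (b : smoothAlg O') : Prop :=
  ∀ p : O, ∃ q : O', (q : E') = ι p ∧ evalHom p a = evalHom q b

section Pullback

variable {E' : Type*} [NormedAddCommGroup E'] [NormedSpace ℝ E'] [NormedSpace ℂ E']
  {O' : Opens E'} {L : E →L[ℂ] E'} {ι : E → E'} {a : smoothAlg O} {b : smoothAlg O'}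

theorem IsPullback.rep (h : IsPullback ι a b) : Rep a (fun z => zeroExt O' b.1 (ι z)) := fun p => by
  obtain ⟨q, hq, hab⟩ := h p
  change evalHom p a = zeroExt O' b.1 (ι p)
  rw [← hq, zeroExt_apply]
  exact hab

variable [IsScalarTower ℝ ℂ E] [IsScalarTower ℝ ℂ E']

theorem IsPullback.dirD (h : IsPullback ι a b)
    (hι : ∀ z, HasFDerivAt ι (L.restrictScalars ℝ) z) (v : E) :
    IsPullback ι (dirD O v a) (dirD O' (L v) b) := fun p => by
  obtain ⟨q, hq, -⟩ := h p
  refine ⟨q, hq, ?_⟩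
  rw [(h.rep.dirD v).evalHom, ((rep_zeroExt b).dirD _).evalHom]
  have hb : HasFDerivAt (zeroExt O' b.1) (fderiv ℝ (zeroExt O' b.1) q) (ι p) :=
    hq ▸ ((rep_zeroExt b).differentiableAt q).hasFDerivAt
  have hc : HasFDerivAt (fun z => zeroExt O' b.1 (ι z)) _ p := hb.comp (p : E) (hι p)
  rw [hc.fderiv]
  rfl

/-- The linear part `L` is complex linear, so the chain rule in the directions `v` and `I • v`
combines into a Wirtinger derivative in the direction `L v`, with no antiholomorphic contribution.
-/
theorem IsPullback.wirtD (h : IsPullback ι a b)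
    (hι : ∀ z, HasFDerivAt ι (L.restrictScalars ℝ) z) (v : E) :
    IsPullback ι (wirtD O v a) (wirtD O' (L v) b) := fun p => by
  obtain ⟨q, hq, h1⟩ := h.dirD hι v p
  obtain ⟨q', hq', h2⟩ := h.dirD hι (Complex.I • v) p
  obtain rfl : q = q' := Subtype.ext (hq.trans hq'.symm)
  refine ⟨q, hq, ?_⟩
  simp only [wirtD_apply, map_smul, map_sub, h1, h2]

theorem IsPullback.wirtBarD (h : IsPullback ι a b)
    (hι : ∀ z, HasFDerivAt ι (L.restrictScalars ℝ) z) (v : E) :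
    IsPullback ι (wirtBarD O v a) (wirtBarD O' (L v) b) := fun p => by
  obtain ⟨q, hq, h1⟩ := h.dirD hι v p
  obtain ⟨q', hq', h2⟩ := h.dirD hι (Complex.I • v) p
  obtain rfl : q = q' := Subtype.ext (hq.trans hq'.symm)
  refine ⟨q, hq, ?_⟩
  simp only [wirtBarD_apply, map_smul, map_add, h1, h2]

end Pullback

end SmoothAlgebra

/-! ### The iterated Leibniz rule as a sum over digraphs with labelled edges. -/

section Leibniz

variable {A : Type*} [CommRing A] [Algebra ℂ A] {n : ℕ}

/-- The iterated derivative with multi-index `α` along a family of derivations. -/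
def multiD (D : Fin n → Derivation ℂ A A) (α : Fin n → ℕ) (a : A) : A :=
  (List.finRange n).foldr (fun i b => (D i)^[α i] b) a

theorem foldr_iterate_comm (D : Fin n → Derivation ℂ A A) (T : A → A)
    (hT : ∀ i a, T (D i a) = D i (T a)) (α : Fin n → ℕ) (l : List (Fin n)) (a : A) :
    T (l.foldr (fun i b => (D i)^[α i] b) a) = l.foldr (fun i b => (D i)^[α i] b) (T a) := by
  induction l with
  | nil => rfl
  | cons j l ih =>
    simp only [List.foldr_cons]
    rw [← ih, (Function.Commute.iterate_right (f := T) (g := D j) (hT j) (α j)).eq]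

theorem multiD_comm (D : Fin n → Derivation ℂ A A) (T : A → A)
    (hT : ∀ i a, T (D i a) = D i (T a)) (α : Fin n → ℕ) (a : A) :
    T (multiD D α a) = multiD D α (T a) := foldr_iterate_comm D T hT α _ a

theorem multiD_zero (D : Fin n → Derivation ℂ A A) (a : A) : multiD D 0 a = a := by
  unfold multiD
  induction List.finRange n with
  | nil => rfl
  | cons j l ih => simp

theorem multiD_sub (D : Fin n → Derivation ℂ A A) (α : Fin n → ℕ) (a b : A) :
    multiD D α (a - b) = multiD D α a - multiD D α b := by
  unfold multiD
  induction List.finRange n with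
  | nil => rfl
  | cons j l ih =>
    simp only [List.foldr_cons, ih]
    exact iterate_map_sub (D j) _ _ _

theorem multiD_add (D : Fin n → Derivation ℂ A A) (α : Fin n → ℕ) (a b : A) :
    multiD D α (a + b) = multiD D α a + multiD D α b := by
  unfold multiD
  induction List.finRange n with
  | nil => rfl
  | cons j l ih =>
    simp only [List.foldr_cons, ih]
    exact iterate_map_add (D j) _ _ _

theorem multiD_map_zero (D : Fin n → Derivation ℂ A A) (α : Fin n → ℕ) :
    multiD D α 0 = 0 := by
  simpa using multiD_sub D α 0 0

/-- `multiD` applies the derivations in a fixed order; commutativity brings the additional `D i` to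
the front. The proof goes through duplicate-free lists so that `i` is met only once. -/
theorem multiD_add_single (D : Fin n → Derivation ℂ A A)
    (hD : ∀ i j a, D i (D j a) = D j (D i a)) (α : Fin n → ℕ) (i : Fin n) (a : A) :
    multiD D (α + Pi.single i 1) a = D i (multiD D α a) := by
  have key : ∀ l : List (Fin n), l.Nodup →
      l.foldr (fun j b => (D j)^[(α + Pi.single i 1 : Fin n → ℕ) j] b) a =
        if i ∈ l then D i (l.foldr (fun j b => (D j)^[α j] b) a)
        else l.foldr (fun j b => (D j)^[α j] b) a := by
    intro l hl
    induction l with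
    | nil => simp
    | cons j l ih =>
      rw [List.nodup_cons] at hl
      simp only [List.foldr_cons, ih hl.2]
      by_cases hij : i = j
      · subst hij
        simp [hl.1, Function.iterate_succ_apply']
      · have h0 : (Pi.single i 1 : Fin n → ℕ) j = 0 := Pi.single_eq_of_ne (Ne.symm hij) 1
        simp only [Pi.add_apply, h0, add_zero, List.mem_cons, hij, false_or]
        split_ifs
        · rw [(Function.Commute.iterate_right (f := D i) (g := D j) (hD i j) (α j)).eq]
        · rfl
  exact (key _ (List.nodup_finRange n)).trans (if_pos (List.mem_finRange i))

theorem derivation_prod {V : Type*} [DecidableEq V] (d : Derivation ℂ A A) (s : Finset V)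
    (F : V → A) :
    d (∏ v ∈ s, F v) = ∑ w ∈ s, ∏ v ∈ s, if v = w then d (F v) else F v := by
  induction s using Finset.induction_on with
  | empty => simp
  | insert a s ha ih =>
    rw [Finset.prod_insert ha, Derivation.leibniz, ih, Finset.sum_insert ha,
      Finset.prod_insert ha, if_pos rfl, add_comm]
    congr 1
    · rw [smul_eq_mul, mul_comm]
      congr 1
      exact Finset.prod_congr rfl fun v hv => (if_neg (ne_of_mem_of_not_mem hv ha)).symm
    · rw [smul_eq_mul, Finset.mul_sum]
      refine Finset.sum_congr rfl fun w hw => ?_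
      rw [Finset.prod_insert ha, if_neg (ne_of_mem_of_not_mem hw ha).symm]

/-- The number of edges at `v` (with respect to `f`) carrying each of the labels. -/
def labelCount {E V ι : Type*} [Fintype E] [DecidableEq V] [DecidableEq ι] (f : E → V) (c : E → ι)
    (v : V) : ι → ℕ := fun i => (Finset.univ.filter fun e => f e = v ∧ c e = i).card

/-- One more derivative is one more edge: a new edge at `w` with label `i` raises the multi-index at
`w` alone. -/
theorem labelCount_cons {V : Type*} [DecidableEq V] {m : ℕ} (w v : V) (f : Fin m → V) (i : Fin n)
    (c : Fin m → Fin n) :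
    labelCount (Fin.cons w f : Fin (m + 1) → V) (Fin.cons i c : Fin (m + 1) → Fin n) v =
      labelCount f c v + if v = w then Pi.single i 1 else 0 := by
  funext j
  simp only [labelCount, Finset.card_filter, Fin.sum_univ_succ, Fin.cons_zero, Fin.cons_succ,
    Pi.add_apply]
  rw [add_comm]
  congr 1
  by_cases h : v = w <;> by_cases h' : j = i <;>
    simp [h, h', eq_comm (a := w), eq_comm (a := i)]

theorem sum_fin_succ_fun {X M : Type*} [Fintype X] [AddCommMonoid M] {m : ℕ}
    (F : (Fin (m + 1) → X) → M) :
    ∑ f, F f = ∑ x : X, ∑ f : Fin m → X, F (Fin.cons x f) := by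
  rw [← (Fin.consEquiv (fun _ => X)).sum_comp, Fintype.sum_prod_type]
  rfl

/-- The flat Laplacian `∑ ∂_i ∂̄_i` of two families of derivations. -/
def flatLaplacian (D D' : Fin n → Derivation ℂ A A) (a : A) : A := ∑ i, D i (D' i a)

theorem flatLaplacian_sum (D D' : Fin n → Derivation ℂ A A) {X : Type*} (s : Finset X)
    (F : X → A) :
    flatLaplacian D D' (∑ x ∈ s, F x) = ∑ x ∈ s, flatLaplacian D D' (F x) := by
  simp only [flatLaplacian, map_sum]
  exact Finset.sum_comm

theorem flatLaplacian_iterate_sum (D D' : Fin n → Derivation ℂ A A) {X : Type*} (s : Finset X)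
    (F : X → A) (m : ℕ) :
    (flatLaplacian D D')^[m] (∑ x ∈ s, F x) = ∑ x ∈ s, (flatLaplacian D D')^[m] (F x) := by
  induction m with
  | zero => rfl
  | succ m ih => simp only [Function.iterate_succ_apply', ih, flatLaplacian_sum]

theorem flatLaplacian_iterate_smul (D D' : Fin n → Derivation ℂ A A) (c : ℂ) (a : A) (m : ℕ) :
    (flatLaplacian D D')^[m] (c • a) = c • (flatLaplacian D D')^[m] a := by
  induction m with
  | zero => rfl
  | succ m ih =>
    simp only [Function.iterate_succ_apply', ih, flatLaplacian, Derivation.map_smul,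
      Finset.smul_sum]

theorem flatLaplacian_prod (D D' : Fin n → Derivation ℂ A A) {V : Type*} [Fintype V]
    [DecidableEq V] (F : V → A) :
    flatLaplacian D D' (∏ v, F v) = ∑ i, ∑ w, ∑ w', ∏ v,
      if v = w then D i (if v = w' then D' i (F v) else F v)
      else (if v = w' then D' i (F v) else F v) := by
  refine Finset.sum_congr rfl fun i _ => ?_
  rw [derivation_prod, map_sum, Finset.sum_comm]
  refine Finset.sum_congr rfl fun w' _ => ?_
  rw [derivation_prod]

/-- The iterated Leibniz rule: powers of the Laplacian of a product are sums over digraphs with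
labelled edges. -/
theorem flatLaplacian_iterate_prod (D D' : Fin n → Derivation ℂ A A)
    (hD : ∀ i j a, D i (D j a) = D j (D i a)) (hD' : ∀ i j a, D' i (D' j a) = D' j (D' i a))
    (hDD' : ∀ i j a, D i (D' j a) = D' j (D i a)) {V : Type*} [Fintype V]
    [DecidableEq V] (F : V → A) (m : ℕ) :
    (flatLaplacian D D')^[m] (∏ v, F v) =
      ∑ c : Fin m → Fin n, ∑ src : Fin m → V, ∑ tgt : Fin m → V,
        ∏ v, multiD D (labelCount src c v) (multiD D' (labelCount tgt c v) (F v)) := by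
  induction m with
  | zero =>
    have h (f : Fin 0 → V) (c : Fin 0 → Fin n) (v : V) : labelCount f c v = 0 := by
      funext i; simp [labelCount]
    simp [h, multiD_zero]
  | succ m ih =>
    rw [Function.iterate_succ_apply', ih, flatLaplacian_sum, sum_fin_succ_fun, Finset.sum_comm]
    refine Finset.sum_congr rfl fun c _ => ?_
    simp only [sum_fin_succ_fun, flatLaplacian_sum, flatLaplacian_prod]
    -- The sums are interchanged to bring outside the label `i`, the tail `w` and the head `w'` of
    -- the new edge.
    rw [Finset.sum_congr rfl fun _ _ => Finset.sum_comm, Finset.sum_comm]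
    refine Finset.sum_congr rfl fun i _ => ?_
    rw [Finset.sum_congr rfl fun _ _ => Finset.sum_comm, Finset.sum_comm]
    refine Finset.sum_congr rfl fun w _ => ?_
    refine Finset.sum_congr rfl fun src _ => ?_
    rw [Finset.sum_comm]
    refine Finset.sum_congr rfl fun w' _ => ?_
    refine Finset.sum_congr rfl fun tgt _ => ?_
    refine Finset.prod_congr rfl fun v _ => ?_
    rw [labelCount_cons, labelCount_cons]
    have h1 : multiD D (labelCount src c v + if v = w then Pi.single i 1 else 0) =
        fun a => if v = w then D i (multiD D (labelCount src c v) a)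
          else multiD D (labelCount src c v) a := by
      funext a; split_ifs
      · rw [multiD_add_single D hD]
      · rw [add_zero]
    have h2 (a) : multiD D' (labelCount tgt c v + if v = w' then Pi.single i 1 else 0) a =
        if v = w' then D' i (multiD D' (labelCount tgt c v) a)
          else multiD D' (labelCount tgt c v) a := by
      split_ifs
      · rw [multiD_add_single D' hD']
      · rw [add_zero]
    rw [h1, h2]
    by_cases h : v = w' <;> 
      simp only [h, if_true, if_false, multiD_comm D (D' i) (fun j a => (hDD' j i a).symm)]

end Leibniz

/-! ### Expansion of `det (1 + M)` into principal minors. -/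

section PrincipalMinors

theorem sum_eq_sum_embedding {ι V M : Type*} [Fintype ι] [DecidableEq ι] [Fintype V]
    [AddCommMonoid M] (F : (ι → V) → M) (hF : ∀ u, ¬ Function.Injective u → F u = 0) :
    ∑ u, F u = ∑ u : ι ↪ V, F u := by
  classical
  rw [← (Equiv.subtypeInjectiveEquivEmbedding ι V).sum_comp,
    ← Finset.sum_filter_of_ne (p := Function.Injective) fun u _ h => by_contra fun hu => h (hF u hu)]
  exact Finset.sum_subtype _ (by simp) F

variable {V : Type*} [Fintype V] [DecidableEq V] {A : Type*} [CommRing A]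

/-- Each `s`-element subset is the image of `s!` embeddings, and a simultaneous reindexing of rows
and columns preserves the determinant. -/
theorem sum_embedding_det_submatrix (M : Matrix V V A) (s : ℕ) :
    ∑ u : Fin s ↪ V, (M.submatrix u u).det = s.factorial • ∑ W ∈ Finset.univ.powersetCard s,
      (M.submatrix (Subtype.val : W → V) (Subtype.val : W → V)).det := by
  rw [← Finset.sum_fiberwise_of_maps_to (s := Finset.univ) (t := Finset.univ.powersetCard s)
    (g := fun u : Fin s ↪ V => Finset.univ.map u) (by simp), Finset.smul_sum]
  refine Finset.sum_congr rfl fun W hW => ?_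
  have hcard : Fintype.card (Fin s) = Fintype.card W := by
    simpa using (Finset.mem_powersetCard.1 hW).2.symm
  have hdet : ∀ e : Fin s ≃ W, (M.submatrix (fun a => (e a : V)) fun a => (e a : V)).det =
      (M.submatrix (Subtype.val : W → V) (Subtype.val : W → V)).det := fun e =>
    Matrix.det_submatrix_equiv_self e (M.submatrix (Subtype.val : W → V) Subtype.val)
  have hsum : ∑ e : Fin s ≃ W, (M.submatrix (fun a => (e a : V)) fun a => (e a : V)).det =
      s.factorial • (M.submatrix (Subtype.val : W → V) (Subtype.val : W → V)).det := by
    rw [Finset.sum_congr rfl fun e _ => hdet e, Finset.sum_const, Finset.card_univ,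
      Fintype.card_equiv (Fintype.equivOfCardEq hcard), Fintype.card_fin]
  rw [← hsum]
  symm
  refine Finset.sum_bij (fun e _ => e.toEmbedding.trans (Function.Embedding.subtype (· ∈ W)))
    (fun e _ => ?_) (fun e _ e' _ h => ?_) (fun u hu => ?_) (fun e _ => rfl)
  · rw [Finset.mem_filter]
    refine ⟨Finset.mem_univ _, ?_⟩
    ext w
    simp only [Finset.mem_map, Finset.mem_univ, true_and]
    constructor
    · rintro ⟨a, rfl⟩
      exact (e a).2
    · exact fun hw => ⟨e.symm ⟨w, hw⟩, by simp⟩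
  · ext a
    exact congrArg (fun f : Fin s ↪ V => f a) h
  · have hu' : Finset.univ.map u = W := (Finset.mem_filter.1 hu).2
    have hmem : ∀ a, u a ∈ W := fun a => by rw [← hu']; simp
    have hinj : Function.Injective fun a => (⟨u a, hmem a⟩ : W) := fun a b h =>
      u.injective (congrArg Subtype.val h)
    refine ⟨Equiv.ofBijective _ ((Fintype.bijective_iff_injective_and_card _).2 ⟨hinj, hcard⟩),
      Finset.mem_univ _, ?_⟩
    ext a
    rfl

variable [Algebra ℂ A]

/-- The expansion of `det (1 + M)` into principal minors, indexed by injective tuples. -/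
theorem det_one_add_eq_sum_embedding (M : Matrix V V A) {N : ℕ} (hN : Fintype.card V < N) :
    (1 + M).det = ∑ s ∈ Finset.range N,
      (1 / (s.factorial : ℂ)) • ∑ u : Fin s ↪ V, (M.submatrix u u).det := by
  open Polynomial in
  have hc := Matrix.coeff_det_one_add_X_smul_eq_sum_minors M
  -- The sums of principal minors are the coefficients of `det (1 + X M)`, a polynomial of degree
  -- less than `N`, which is then evaluated at `1`.
  set p : A[X] := Matrix.det (1 + (X : A[X]) • M.map C) with hp
  have hdeg : p.natDegree < N := by
    refine lt_of_le_of_lt ?_ hN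
    rw [natDegree_le_iff_coeff_eq_zero]
    intro m hm
    rw [hc, Finset.powersetCard_eq_empty.2 (by simpa using hm), Finset.sum_empty]
  have heval : p.eval 1 = (1 + M).det := by
    rw [hp, ← coe_evalRingHom, RingHom.map_det]
    congr 1
    ext i j
    by_cases h : i = j <;> simp [h]
  rw [← heval, eval_eq_sum_range' hdeg]
  refine Finset.sum_congr rfl fun s _ => ?_
  have hs : (s.factorial : ℂ) ≠ 0 := Nat.cast_ne_zero.2 s.factorial_ne_zero
  rw [hc, one_pow, mul_one, sum_embedding_det_submatrix, ← Nat.cast_smul_eq_nsmul ℂ, smul_smul,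
    one_div_mul_cancel hs, one_smul]

/-- The expansion of `det (1 + M)` into principal minors, indexed by tuples. -/
theorem det_one_add_eq_sum_tuple (M : Matrix V V A) {N : ℕ} (hN : Fintype.card V < N) :
    (1 + M).det = ∑ s ∈ Finset.range N,
      (1 / (s.factorial : ℂ)) • ∑ u : Fin s → V, (M.submatrix u u).det := by
  rw [det_one_add_eq_sum_embedding M hN]
  refine Finset.sum_congr rfl fun s _ => ?_
  rw [sum_eq_sum_embedding]
  intro u hu
  simp only [Function.Injective, not_forall] at hu
  obtain ⟨a, b, hab, hne⟩ := hu
  exact Matrix.det_zero_of_row_eq hne (by ext j; simp [hab])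

end PrincipalMinors

/-! ### Contractions along digraphs, and the expansion of `det (A - I)`. -/

section GraphSums

variable {n : ℕ}

/-- The contraction of the tensors `t` along a digraph. -/
def contraction (t : (Fin n → ℕ) → (Fin n → ℕ) → ℂ) {E V : Type*} [Fintype E] [DecidableEq E]
    [Fintype V] [DecidableEq V] (src tgt : E → V) : ℂ :=
  ∑ c : E → Fin n, ∏ v, t (labelCount src c v) (labelCount tgt c v)

/-- The sum of the contractions over the digraphs with vertices `Fin s ⊕ Fin l` having the edges
`σ a → a` on the first `s` vertices, and `m` further edges. -/
def permContraction (t : (Fin n → ℕ) → (Fin n → ℕ) → ℂ) (s l m : ℕ) (σ : Equiv.Perm (Fin s)) : ℂ :=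
  ∑ src : Fin m → Fin s ⊕ Fin l, ∑ tgt : Fin m → Fin s ⊕ Fin l,
    contraction t (Sum.elim (fun a => Sum.inl (σ a)) src) (Sum.elim Sum.inl tgt)

/-- The signed sum of `permContraction` over all permutations. -/
def detContraction (t : (Fin n → ℕ) → (Fin n → ℕ) → ℂ) (s l m : ℕ) : ℂ :=
  ∑ σ : Equiv.Perm (Fin s), ((Equiv.Perm.sign σ : ℤ) : ℂ) * permContraction t s l m σ

variable {E V E' V' : Type*} [Fintype E] [DecidableEq E] [Fintype V] [DecidableEq V]
  [Fintype E'] [DecidableEq E'] [Fintype V'] [DecidableEq V']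

theorem labelCount_congr (eE : E ≃ E') (eV : V ≃ V') (f : E' → V') (c : E' → Fin n) (v : V) :
    labelCount (fun e => eV.symm (f (eE e))) (fun e => c (eE e)) v = labelCount f c (eV v) := by
  funext i
  refine Finset.card_equiv eE fun e => ?_
  simp [Equiv.symm_apply_eq]

theorem contraction_congr (t : (Fin n → ℕ) → (Fin n → ℕ) → ℂ) (eE : E ≃ E') (eV : V ≃ V')
    (src tgt : E' → V') :
    contraction t (fun e => eV.symm (src (eE e))) (fun e => eV.symm (tgt (eE e))) =
      contraction t src tgt := by
  unfold contraction
  rw [← (eE.arrowCongr (Equiv.refl (Fin n))).symm.sum_comp]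
  refine Finset.sum_congr rfl fun c _ => ?_
  rw [← eV.prod_comp]
  refine Finset.prod_congr rfl fun v _ => ?_
  exact congrArg₂ t (labelCount_congr eE eV src c v) (labelCount_congr eE eV tgt c v)

theorem exists_equiv_sum_of_embedding {s m : ℕ} (η : Fin s ↪ E) (hE : Fintype.card E = s + m) :
    ∃ e : E ≃ Fin s ⊕ Fin m, ∀ a, e (η a) = Sum.inl a := by
  have hc : Fintype.card ((Set.range η)ᶜ : Set E) = Fintype.card (Fin m) := by
    rw [Fintype.card_compl_set, hE, Set.card_range_of_injective η.injective]
    simp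
  let e : E ≃ Fin s ⊕ Fin m := (Equiv.Set.sumCompl (Set.range η)).symm.trans
    (Equiv.sumCongr (Equiv.ofInjective η η.injective).symm (Fintype.equivOfCardEq hc))
  refine ⟨e, fun a => ?_⟩
  have : (Equiv.Set.sumCompl (Set.range η)).symm (η a) = Sum.inl ⟨η a, a, rfl⟩ :=
    Equiv.Set.sumCompl_symm_apply_of_mem _
  simp [e, this]

theorem sum_sum_fun {X M α β : Type*} [Fintype X] [Fintype α] [Fintype β] [DecidableEq α]
    [DecidableEq β] [AddCommMonoid M] (F : (α ⊕ β → X) → M) :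
    ∑ f, F f = ∑ f : α → X, ∑ g : β → X, F (Sum.elim f g) := by
  rw [← (Equiv.sumArrowEquivProdArrow α β X).symm.sum_comp, Fintype.sum_prod_type]
  rfl

/-- Renumbering moves `η` and `u` to the first `s` edges and vertices. The indicators then fix these
edges to be `σ a → a` and leave the other `m` free, so the result depends on neither `η` nor `u`. -/
theorem sum_contraction_of_embeddings (t : (Fin n → ℕ) → (Fin n → ℕ) → ℂ) {s l m : ℕ}
    (hE : Fintype.card E = s + m) (hV : Fintype.card V = s + l) (η : Fin s ↪ E) (u : Fin s ↪ V)
    (σ : Equiv.Perm (Fin s)) :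
    (∑ src : E → V, ∑ tgt : E → V,
      (∏ a, if src (η a) = u (σ a) ∧ tgt (η a) = u a then (1 : ℂ) else 0) *
        contraction t src tgt) = permContraction t s l m σ := by
  obtain ⟨eE, hη⟩ := exists_equiv_sum_of_embedding η hE
  obtain ⟨eV, hu⟩ := exists_equiv_sum_of_embedding u hV
  have hu' : ∀ (x : Fin s ⊕ Fin l) a, eV.symm x = u a ↔ x = Sum.inl a := fun x a => by
    rw [Equiv.symm_apply_eq, hu]
  rw [← (eE.arrowCongr eV).symm.sum_comp]
  simp only [← (eE.arrowCongr eV).symm.sum_comp (fun tgt : E → V => _ * contraction t _ tgt)]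
  have hcoe (f : Fin s ⊕ Fin m → Fin s ⊕ Fin l) :
      (eE.arrowCongr eV).symm f = fun e => eV.symm (f (eE e)) := rfl
  simp only [hcoe, contraction_congr, hη, hu', sum_sum_fun, Sum.elim_inl]
  rw [Finset.sum_eq_single fun a => Sum.inl (σ a)]
  · refine Finset.sum_congr rfl fun src _ => ?_
    rw [Finset.sum_eq_single Sum.inl]
    · simp
    · intro f _ hf
      obtain ⟨a, ha⟩ := Function.ne_iff.1 hf
      refine Finset.sum_eq_zero fun g _ => ?_
      rw [Finset.prod_eq_zero (Finset.mem_univ a) (if_neg fun h => ha h.2), zero_mul]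
    · simp
  · intro f _ hf
    obtain ⟨a, ha⟩ := Function.ne_iff.1 hf
    refine Finset.sum_eq_zero fun _ _ => Finset.sum_eq_zero fun _ _ =>
      Finset.sum_eq_zero fun g _ => ?_
    rw [Finset.prod_eq_zero (Finset.mem_univ a) (if_neg fun h => ha h.1), zero_mul]
  · simp

/-- The adjacency matrix of a digraph. -/
def adjMat (src tgt : E → V) : Matrix V V ℂ :=
  Matrix.of fun i j => ∑ e, if src e = i ∧ tgt e = j then 1 else 0

/-- Multiplying out chooses an edge for each `a`. The heads `u a` are distinct, so the chosen edges
are distinct and only injective choices contribute. -/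
theorem prod_adjMat (src tgt : E → V) {s : ℕ} (u : Fin s ↪ V) (σ : Equiv.Perm (Fin s)) :
    ∏ a, adjMat src tgt (u (σ a)) (u a) = ∑ η : Fin s ↪ E,
      ∏ a, if src (η a) = u (σ a) ∧ tgt (η a) = u a then (1 : ℂ) else 0 := by
  simp only [adjMat, Matrix.of_apply]
  rw [Finset.prod_univ_sum, Fintype.piFinset_univ,
    sum_eq_sum_embedding (ι := Fin s) (V := E) (fun η => ∏ a, if src (η a) = u (σ a) ∧ tgt (η a) = u a then (1 : ℂ) else 0)]
  intro η hη
  by_contra h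
  refine hη fun a b hab => u.injective ?_
  have h' : ∀ a, src (η a) = u (σ a) ∧ tgt (η a) = u a := fun a => by
    by_contra ha
    exact h (Finset.prod_eq_zero (Finset.mem_univ a) (if_neg ha))
  rw [← (h' a).2, ← (h' b).2, hab]

/-- For fixed `σ` the summand is the same for all embeddings `u` and `η`; the two falling factorials
count these embeddings. -/
theorem sum_det_submatrix_mul_contraction (t : (Fin n → ℕ) → (Fin n → ℕ) → ℂ) {s l m : ℕ}
    (hE : Fintype.card E = s + m) (hV : Fintype.card V = s + l) :
    (∑ src : E → V, ∑ tgt : E → V, (∑ u : Fin s ↪ V, ((adjMat src tgt).submatrix u u).det) *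
      contraction t src tgt) =
      (s + l).descFactorial s * (s + m).descFactorial s * detContraction t s l m := by
  have h1 : ∀ src tgt : E → V, (∑ u : Fin s ↪ V, ((adjMat src tgt).submatrix u u).det) *
      contraction t src tgt = ∑ σ : Equiv.Perm (Fin s), ∑ u : Fin s ↪ V, ∑ η : Fin s ↪ E,
        ((Equiv.Perm.sign σ : ℤ) : ℂ) *
        ((∏ a, if src (η a) = u (σ a) ∧ tgt (η a) = u a then (1 : ℂ) else 0) *
          contraction t src tgt) := by
    intro src tgt
    simp only [Matrix.det_apply', Matrix.submatrix_apply, prod_adjMat]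
    rw [Finset.sum_comm, Finset.sum_mul]
    refine Finset.sum_congr rfl fun σ _ => ?_
    rw [Finset.sum_mul]
    refine Finset.sum_congr rfl fun u _ => ?_
    rw [mul_assoc, Finset.sum_mul, Finset.mul_sum]
  simp only [h1]
  have h2 : ∀ G : (E → V) → (E → V) → Equiv.Perm (Fin s) → (Fin s ↪ V) → (Fin s ↪ E) → ℂ,
      (∑ src, ∑ tgt, ∑ σ, ∑ u, ∑ η, G src tgt σ u η) =
        ∑ σ, ∑ u, ∑ η, ∑ src, ∑ tgt, G src tgt σ u η := by
    intro G
    simp only [← Fintype.sum_prod_type' (f := fun src tgt => ∑ σ, ∑ u, ∑ η, G src tgt σ u η),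
      ← Fintype.sum_prod_type' (f := fun src tgt => G src tgt _ _ _)]
    rw [Finset.sum_comm]
    refine Finset.sum_congr rfl fun σ _ => ?_
    rw [Finset.sum_comm]
    refine Finset.sum_congr rfl fun u _ => ?_
    rw [Finset.sum_comm]
  rw [h2]
  simp only [← Finset.mul_sum, sum_contraction_of_embeddings t hE hV, Finset.sum_const,
    Finset.card_univ, Fintype.card_embedding_eq, Fintype.card_fin, hE, hV, nsmul_eq_mul,
    detContraction]
  rw [Finset.mul_sum]
  refine Finset.sum_congr rfl fun σ _ => ?_
  ring

/-- With `v = s + l`, the falling factorials from the choice of vertices and edges reduce `v! (v +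
k)!` to `l! (k + l)!`; the remaining `s!` is that of the minor expansion. -/
theorem sum_det_mul_contraction (t : (Fin n → ℕ) → (Fin n → ℕ) → ℂ) (v k : ℕ) :
    (∑ src : Fin (v + k) → Fin v, ∑ tgt : Fin (v + k) → Fin v,
      (adjMat src tgt - 1).det * contraction t src tgt) /
        ((v.factorial : ℂ) * ((v + k).factorial : ℂ)) =
      ∑ p ∈ Finset.HasAntidiagonal.antidiagonal v,
        (-1) ^ p.2 / ((p.1.factorial : ℂ) * p.2.factorial * (k + p.2).factorial) *
          detContraction t p.1 p.2 (k + p.2) := by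
  have hdet : ∀ src tgt : Fin (v + k) → Fin v, (adjMat src tgt - 1).det =
      ∑ s ∈ Finset.range (v + 1), (-1) ^ (v + s) / (s.factorial : ℂ) *
        ∑ u : Fin s ↪ Fin v, ((adjMat src tgt).submatrix u u).det := by
    intro src tgt
    -- The outer sign gives `(-1) ^ v` and each minor of `-A` gives `(-1) ^ s`; together they amount
    -- to `(-1) ^ l`.
    rw [show adjMat src tgt - 1 = -(1 + -adjMat src tgt) by abel, Matrix.det_neg,
      det_one_add_eq_sum_embedding _ (N := v + 1) (by simp), Fintype.card_fin, Finset.mul_sum]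
    refine Finset.sum_congr rfl fun s _ => ?_
    have : ∀ u : Fin s ↪ Fin v, ((-adjMat src tgt).submatrix u u).det =
        (-1) ^ s * ((adjMat src tgt).submatrix u u).det := fun u => by
      rw [Matrix.submatrix_neg, Pi.neg_apply, Pi.neg_apply, Matrix.det_neg, Fintype.card_fin]
    simp only [this, ← Finset.mul_sum, smul_eq_mul]
    ring
  simp only [hdet, Finset.sum_mul]
  rw [Finset.sum_congr rfl fun _ _ => Finset.sum_comm, Finset.sum_comm,
    Finset.Nat.sum_antidiagonal_eq_sum_range_succ_mk, Finset.sum_div]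
  refine Finset.sum_congr rfl fun s hs => ?_
  obtain ⟨l, rfl⟩ := Nat.exists_eq_add_of_le (Nat.lt_succ_iff.1 (Finset.mem_range.1 hs))
  have h := sum_det_submatrix_mul_contraction (E := Fin (s + l + k)) (V := Fin (s + l)) t
    (s := s) (l := l) (m := k + l) (by simp; ring) (by simp)
  simp only [mul_assoc, ← Finset.mul_sum, h, Nat.add_sub_cancel_left]
  have e1 : ((s + l).factorial : ℂ) = l.factorial * (s + l).descFactorial s := by
    have := Nat.factorial_mul_descFactorial (n := s + l) (k := s) (by omega)
    rw [Nat.add_sub_cancel_left] at this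
    exact_mod_cast this.symm
  have e2 : ((s + l + k).factorial : ℂ) = (k + l).factorial * (s + (k + l)).descFactorial s := by
    have := Nat.factorial_mul_descFactorial (n := s + (k + l)) (k := s) (by omega)
    rw [Nat.add_sub_cancel_left] at this
    rw [show s + l + k = s + (k + l) by ring]
    exact_mod_cast this.symm
  have n1 : ((s + l).descFactorial s : ℂ) ≠ 0 := by
    exact_mod_cast (Nat.descFactorial_pos.2 (by omega)).ne'
  have n2 : ((s + (k + l)).descFactorial s : ℂ) ≠ 0 := by
    exact_mod_cast (Nat.descFactorial_pos.2 (by omega)).ne'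
  have f (j : ℕ) : (j.factorial : ℂ) ≠ 0 := Nat.cast_ne_zero.2 j.factorial_ne_zero
  have hsign : (-1 : ℂ) ^ (s + l + s) = (-1) ^ l := by
    rw [show s + l + s = 2 * s + l by ring, pow_add, pow_mul]; simp
  rw [e1, e2, hsign]
  have := f s; have := f l; have := f (k + l)
  field_simp

end GraphSums

/-! ### Vanishing for unstable digraphs, and label counts of permutation edges. -/

section Degrees

variable {n : ℕ} {E V : Type*} [Fintype E] [DecidableEq E] [Fintype V] [DecidableEq V]

theorem sum_labelCount (f : E → V) (c : E → Fin n) (v : V) :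
    ∑ i, labelCount f c v i = (Finset.univ.filter fun e => f e = v).card := by
  rw [Finset.card_eq_sum_card_fiberwise (f := c) (t := Finset.univ) (fun _ _ => Finset.mem_univ _)]
  simp only [labelCount, Finset.filter_filter]

theorem sum_sum_labelCount (f : E → V) (c : E → Fin n) :
    ∑ v, ∑ i, labelCount f c v i = Fintype.card E := by
  simp only [sum_labelCount]
  rw [← Finset.card_eq_sum_card_fiberwise (fun _ _ => Finset.mem_univ _), Finset.card_univ]

theorem contraction_eq_zero {t : (Fin n → ℕ) → (Fin n → ℕ) → ℂ}
    (ht : ∀ α β, ∑ i, α i < 2 ∨ ∑ i, β i < 2 → t α β = 0) {src tgt : E → V}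
    (h : ∃ v, (Finset.univ.filter fun e => src e = v).card < 2 ∨
      (Finset.univ.filter fun e => tgt e = v).card < 2) :
    contraction t src tgt = 0 := by
  obtain ⟨v, hv⟩ := h
  refine Finset.sum_eq_zero fun c _ => Finset.prod_eq_zero (Finset.mem_univ v) (ht _ _ ?_)
  rwa [sum_labelCount, sum_labelCount]

/-- If all `s + l` vertices had indegree at least two, the `s + m` heads would give `s + m ≥ 2 (s +
l)`. Hence some vertex is unstable. -/
theorem detContraction_eq_zero {t : (Fin n → ℕ) → (Fin n → ℕ) → ℂ}
    (ht : ∀ α β, ∑ i, α i < 2 ∨ ∑ i, β i < 2 → t α β = 0) {s l m : ℕ} (h : m < s + 2 * l) :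
    detContraction t s l m = 0 := by
  refine Finset.sum_eq_zero fun σ _ => mul_eq_zero_of_right _ <|
    Finset.sum_eq_zero fun src _ => Finset.sum_eq_zero fun tgt _ => contraction_eq_zero ht ?_
  by_contra! hc
  have h1 := Finset.card_eq_sum_card_fiberwise (s := Finset.univ) (t := Finset.univ)
    (f := (Sum.elim Sum.inl tgt : Fin s ⊕ Fin m → Fin s ⊕ Fin l)) (fun _ _ => Finset.mem_univ _)
  have h2 := Finset.sum_le_sum fun v (_ : v ∈ Finset.univ) => (hc v).2
  rw [← h1] at h2
  simp at h2
  omega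

theorem labelCount_sumElim {E' : Type*} [Fintype E'] [DecidableEq E'] (f : E → V) (g : E' → V)
    (c : E → Fin n) (d : E' → Fin n) (v : V) :
    labelCount (Sum.elim f g) (Sum.elim c d) v = labelCount f c v + labelCount g d v := by
  funext i
  simp only [labelCount, Finset.card_filter, Fintype.sum_sum_type, Sum.elim_inl, Sum.elim_inr,
    Pi.add_apply]
  congr!

theorem labelCount_inl_perm {s l : ℕ} (σ : Equiv.Perm (Fin s)) (c : Fin s → Fin n) (a : Fin s) :
    labelCount (fun b => (Sum.inl (σ b) : Fin s ⊕ Fin l)) c (Sum.inl a) =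
      Pi.single (c (σ⁻¹ a)) 1 := by
  funext i
  simp only [labelCount, Sum.inl.injEq, Pi.single_apply]
  have : (Finset.univ.filter fun b => σ b = a ∧ c b = i) =
      if i = c (σ⁻¹ a) then {σ⁻¹ a} else ∅ := by
    ext b
    split_ifs with h
    · simp only [Finset.mem_filter, Finset.mem_univ, true_and, Finset.mem_singleton,
        Equiv.Perm.eq_inv_iff_eq, and_iff_left_iff_imp]
      rintro rfl
      simp [h]
    · simp only [Finset.mem_filter, Finset.mem_univ, true_and, Finset.notMem_empty, iff_false]
      rintro ⟨rfl, rfl⟩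
      simp at h
  rw [this]
  split_ifs <;> rfl

theorem labelCount_inl_inr {s l : ℕ} (f : Fin s → Fin s) (c : Fin s → Fin n) (b : Fin l) :
    labelCount (fun a => (Sum.inl (f a) : Fin s ⊕ Fin l)) c (Sum.inr b) = 0 := by
  funext i
  simp [labelCount]

end Degrees

/-! ### Evaluation of the operator side from the jets of `h` and `S`. -/

section Expansion

variable {A : Type*} [CommRing A] [Algebra ℂ A] {n : ℕ}

/-- The jets of `h` and `S` are, up to order `k`, given by the tensors `t`. -/
structure JetData (D D' : Fin n → Derivation ℂ A A) (ε : A →ₐ[ℂ] ℂ)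
    (t : (Fin n → ℕ) → (Fin n → ℕ) → ℂ) (k : ℕ) (h : Matrix (Fin n) (Fin n) A) (S : A) : Prop where
  comm : ∀ i j a, D i (D j a) = D j (D i a)
  comm' : ∀ i j a, D' i (D' j a) = D' j (D' i a)
  comm_mixed : ∀ i j a, D i (D' j a) = D' j (D i a)
  vanish : ∀ α β, ∑ i, α i < 2 ∨ ∑ i, β i < 2 → t α β = 0
  jet_pure : ∀ α β, ∑ i, α i = 0 ∨ ∑ i, β i = 0 → ε (multiD D α (multiD D' β S)) = 0
  jet_remainder : ∀ α β, ∑ i, α i ≤ k + 1 → ∑ i, β i ≤ k + 1 →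
    ε (multiD D α (multiD D' β S)) = -t α β
  jet_metric : ∀ i j α β, ∑ i, α i ≤ k → ∑ i, β i ≤ k →
    ε (multiD D α (multiD D' β (h i j))) = t (α + Pi.single i 1) (β + Pi.single j 1)

variable {D D' : Fin n → Derivation ℂ A A} {ε : A →ₐ[ℂ] ℂ}
  {t : (Fin n → ℕ) → (Fin n → ℕ) → ℂ} {k : ℕ} {h : Matrix (Fin n) (Fin n) A} {S : A}

/-- The jet of a product of entries of `h` and factors `S`, of the total bidegree that matters. -/
theorem JetData.prod_jets (H : JetData D D' ε t k h S) {s l : ℕ} (p q : Fin s → Fin n)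
    (α β : Fin s ⊕ Fin l → Fin n → ℕ) (hα : ∑ v, ∑ i, α v i = k + l)
    (hβ : ∑ v, ∑ i, β v i = k + l) :
    (∏ v, ε (multiD D (α v) (multiD D' (β v)
      (Sum.elim (fun a => h (p a) (q a)) (fun _ => S) v)))) =
      (-1) ^ l * ((∏ a, t (α (Sum.inl a) + Pi.single (p a) 1) (β (Sum.inl a) + Pi.single (q a) 1)) *
        ∏ b, t (α (Sum.inr b)) (β (Sum.inr b))) := by
  rw [Fintype.prod_sum_type]
  simp only [Sum.elim_inl, Sum.elim_inr]
  -- A factor `S` lacking derivatives of one type makes both sides vanish. Otherwise each `S` takes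
  -- at least one of the `k + l` derivatives of each type, which leaves at most `k` for an entry of
  -- `h` and at most `k + 1` for an `S`.
  by_cases hz : ∃ b : Fin l, ∑ i, α (Sum.inr b) i = 0 ∨ ∑ i, β (Sum.inr b) i = 0
  · obtain ⟨b, hb⟩ := hz
    have h1 : ∏ b, ε (multiD D (α (Sum.inr b)) (multiD D' (β (Sum.inr b)) S)) = 0 :=
      Finset.prod_eq_zero (Finset.mem_univ b) (H.jet_pure _ _ hb)
    have h2 : ∏ b, t (α (Sum.inr b)) (β (Sum.inr b)) = 0 :=
      Finset.prod_eq_zero (Finset.mem_univ b) (H.vanish _ _ (hb.imp (by omega) (by omega)))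
    rw [h1, h2, mul_zero, mul_zero, mul_zero]
  · push Not at hz
    have bound (γ : Fin s ⊕ Fin l → Fin n → ℕ) (hγ : ∑ v, ∑ i, γ v i = k + l)
        (hpos : ∀ b, ∑ i, γ (Sum.inr b) i ≠ 0) :
        (∀ a, ∑ i, γ (Sum.inl a) i ≤ k) ∧ ∀ b, ∑ i, γ (Sum.inr b) i ≤ k + 1 := by
      rw [Fintype.sum_sum_type] at hγ
      have hl : ∑ b : Fin l, 1 ≤ ∑ b, ∑ i, γ (Sum.inr b) i :=
        Finset.sum_le_sum fun b _ => Nat.one_le_iff_ne_zero.2 (hpos b)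
      simp only [Finset.sum_const, Finset.card_univ, Fintype.card_fin, smul_eq_mul, mul_one] at hl
      refine ⟨fun a => ?_, fun b => ?_⟩
      · have := Finset.single_le_sum (f := fun a => ∑ i, γ (Sum.inl a) i) (fun _ _ => Nat.zero_le _)
          (Finset.mem_univ a)
        omega
      · have h1 := Finset.add_sum_erase Finset.univ (fun b => ∑ i, γ (Sum.inr b) i)
          (Finset.mem_univ b)
        have h2 : ∑ b ∈ Finset.univ.erase b, 1 ≤
            ∑ b ∈ Finset.univ.erase b, ∑ i, γ (Sum.inr b) i :=
          Finset.sum_le_sum fun b _ => Nat.one_le_iff_ne_zero.2 (hpos b)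
        simp only [Finset.sum_const, Finset.card_erase_of_mem (Finset.mem_univ b),
          Finset.card_univ, Fintype.card_fin, smul_eq_mul, mul_one] at h2
        omega
    obtain ⟨hα1, hα2⟩ := bound α hα fun b => (hz b).1
    obtain ⟨hβ1, hβ2⟩ := bound β hβ fun b => (hz b).2
    rw [Finset.prod_congr rfl fun a _ => H.jet_metric (p a) (q a) _ _ (hα1 a) (hβ1 a),
      Finset.prod_congr rfl fun b _ => H.jet_remainder _ _ (hα2 b) (hβ2 b), Finset.prod_neg,
      Finset.card_univ, Fintype.card_fin]
    ring

/-- The tuple `u` labels the permutation edges `σ b → b`. At the vertex `a` the outgoing one is `b =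
σ⁻¹ a` and the incoming one is `b = a`, which are exactly the two indices of `h (u (σ⁻¹ a)) (u a)`.
-/
theorem JetData.eval_perm (H : JetData D D' ε t k h S) (s l : ℕ) (σ : Equiv.Perm (Fin s)) :
    ∑ u : Fin s → Fin n, ε ((flatLaplacian D D')^[k + l]
      ((∏ a, h (u (σ⁻¹ a)) (u a)) * S ^ l)) = (-1) ^ l * permContraction t s l (k + l) σ := by
  have hprod : ∀ u : Fin s → Fin n, (∏ a, h (u (σ⁻¹ a)) (u a)) * S ^ l =
      ∏ v : Fin s ⊕ Fin l, Sum.elim (fun a => h (u (σ⁻¹ a)) (u a)) (fun _ => S) v := fun u => by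
    rw [Fintype.prod_sum_type]
    simp
  have hterm : ∀ (u : Fin s → Fin n) (c : Fin (k + l) → Fin n) (src tgt : Fin (k + l) → Fin s ⊕ Fin l),
      ∏ v, ε (multiD D (labelCount src c v) (multiD D' (labelCount tgt c v)
        (Sum.elim (fun a => h (u (σ⁻¹ a)) (u a)) (fun _ => S) v))) =
      (-1) ^ l * ∏ v, t (labelCount (Sum.elim (fun a => Sum.inl (σ a)) src) (Sum.elim u c) v)
        (labelCount (Sum.elim Sum.inl tgt) (Sum.elim u c) v) := by
    intro u c src tgt
    rw [H.prod_jets (fun a => u (σ⁻¹ a)) u _ _ (by rw [sum_sum_labelCount, Fintype.card_fin])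
      (by rw [sum_sum_labelCount, Fintype.card_fin]), Fintype.prod_sum_type]
    congr 2
    · refine Finset.prod_congr rfl fun a _ => ?_
      have h1 := labelCount_inl_perm (l := l) 1 u a
      simp only [Equiv.Perm.one_apply, inv_one] at h1
      rw [labelCount_sumElim, labelCount_sumElim, labelCount_inl_perm, add_comm, h1,
        add_comm (labelCount tgt c _)]
    · refine Finset.prod_congr rfl fun b _ => ?_
      have h1 := labelCount_inl_inr (l := l) (fun a => a) u b
      rw [labelCount_sumElim, labelCount_sumElim, labelCount_inl_inr (fun a => σ a), zero_add, h1,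
        zero_add]
  simp only [hprod, flatLaplacian_iterate_prod D D' H.comm H.comm' H.comm_mixed, map_sum, map_prod,
    hterm, permContraction, contraction, sum_sum_fun, Finset.mul_sum]
  rw [← Fintype.sum_prod_type' (f := fun (u : Fin s → Fin n) (c : Fin (k + l) → Fin n) => _),
    Finset.sum_comm]
  refine Finset.sum_congr rfl fun src _ => ?_
  rw [Finset.sum_comm]
  refine Finset.sum_congr rfl fun tgt _ => ?_
  rw [← Fintype.sum_prod_type']

theorem JetData.eval_det_mul_pow (H : JetData D D' ε t k h S) (l : ℕ) {N : ℕ} (hN : n < N) :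
    ε ((flatLaplacian D D')^[k + l] ((1 + h).det * S ^ l)) =
      ∑ s ∈ Finset.range N, (-1) ^ l / (s.factorial : ℂ) * detContraction t s l (k + l) := by
  have hdet : ∀ (s : ℕ) (u : Fin s → Fin n), (h.submatrix u u).det =
      ∑ σ : Equiv.Perm (Fin s), ((Equiv.Perm.sign σ : ℤ) : ℂ) • ∏ a, h (u (σ⁻¹ a)) (u a) := by
    intro s u
    -- Replacing `σ` by its inverse, which has the same sign, produces the indices used in
    -- `JetData.eval_perm`.
    rw [Matrix.det_apply, ← Equiv.sum_comp (Equiv.inv (Equiv.Perm (Fin s)))]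
    refine Finset.sum_congr rfl fun σ _ => ?_
    rw [Equiv.inv_apply, Equiv.Perm.sign_inv, Int.cast_smul_eq_zsmul]
    rfl
  rw [det_one_add_eq_sum_tuple h (N := N) (by simpa using hN), Finset.sum_mul,
    flatLaplacian_iterate_sum, map_sum]
  refine Finset.sum_congr rfl fun s _ => ?_
  rw [smul_mul_assoc, flatLaplacian_iterate_smul, map_smul, smul_eq_mul]
  simp only [hdet, Finset.sum_mul, smul_mul_assoc, flatLaplacian_iterate_sum,
    flatLaplacian_iterate_smul, map_sum, map_smul, smul_eq_mul]
  rw [Finset.sum_comm]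
  simp only [← Finset.mul_sum, H.eval_perm, detContraction]
  rw [Finset.mul_sum, Finset.mul_sum]
  refine Finset.sum_congr rfl fun σ _ => ?_
  ring

/-- With `m = k + l`, stability forces `2 (s + l) ≤ s + k + l`, that is `s + l ≤ k`. The range `l ≤
2 k` thus contains every nonzero term, and the terms can be regrouped by `v = s + l`. -/
theorem JetData.sum_eval (H : JetData D D' ε t k h S) :
    ∑ m ∈ Finset.Icc k (3 * k), (1 / ((m.factorial : ℂ) * ((m - k).factorial : ℂ))) *
      ε ((flatLaplacian D D')^[m] ((1 + h).det * S ^ (m - k))) =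
    ∑ v ∈ Finset.range (k + 1), ∑ p ∈ Finset.HasAntidiagonal.antidiagonal v,
        (-1) ^ p.2 / ((p.1.factorial : ℂ) * p.2.factorial * (k + p.2).factorial) *
          detContraction t p.1 p.2 (k + p.2) := by
  -- The bound exceeds `n`, as the minor expansion requires, and `k`, so that every surviving `s` is
  -- in range.
  set N := n + k + 1
  set T := fun p : ℕ × ℕ => (-1 : ℂ) ^ p.2 /
    ((p.1.factorial : ℂ) * p.2.factorial * (k + p.2).factorial) *
          detContraction t p.1 p.2 (k + p.2) with hT
  have hT0 : ∀ p : ℕ × ℕ, k < p.1 + p.2 → T p = 0 := fun p hp => by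
    simp only [hT]
    rw [detContraction_eq_zero H.vanish (by omega), mul_zero]
  have h1 : ∑ m ∈ Finset.Icc k (3 * k), (1 / ((m.factorial : ℂ) * ((m - k).factorial : ℂ))) *
      ε ((flatLaplacian D D')^[m] ((1 + h).det * S ^ (m - k))) =
      ∑ l ∈ Finset.range (2 * k + 1), ∑ s ∈ Finset.range N, T (s, l) := by
    rw [← Finset.Ico_succ_right_eq_Icc, Finset.sum_Ico_eq_sum_range]
    refine Finset.sum_congr (by rw [Nat.succ_eq_succ, Nat.succ_eq_add_one]; congr 1; omega) fun l _ => ?_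
    rw [Nat.add_sub_cancel_left, H.eval_det_mul_pow l (N := N) (by omega), Finset.mul_sum]
    refine Finset.sum_congr rfl fun s _ => ?_
    simp only [hT]
    have f (j : ℕ) : (j.factorial : ℂ) ≠ 0 := Nat.cast_ne_zero.2 j.factorial_ne_zero
    have := f s; have := f l; have := f (k + l)
    field_simp
  rw [h1, Finset.sum_sigma', Finset.sum_sigma']
  refine Finset.sum_bij_ne_zero (fun x _ _ => ⟨x.1 + x.2, (x.2, x.1)⟩) ?_ ?_ ?_ ?_
  · rintro ⟨l, s⟩ - hne
    have : s + l ≤ k := not_lt.1 fun hlt => hne (hT0 (s, l) hlt)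
    simp only [Finset.mem_sigma, Finset.mem_range, Finset.HasAntidiagonal.mem_antidiagonal]
    omega
  · rintro ⟨l, s⟩ - - ⟨l', s'⟩ - - hh
    simp only [Sigma.mk.injEq, heq_eq_eq, Prod.mk.injEq] at hh
    obtain ⟨-, rfl, rfl⟩ := hh
    rfl
  · rintro ⟨v, s, l⟩ hmem hne
    simp only [Finset.mem_sigma, Finset.mem_range, Finset.HasAntidiagonal.mem_antidiagonal] at hmem
    obtain ⟨hv, rfl⟩ := hmem
    refine ⟨⟨l, s⟩, ?_, hne, ?_⟩
    · simp only [Finset.mem_sigma, Finset.mem_range]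
      omega
    · simp only [add_comm]
  · intros
    rfl

end Expansion

variable {n : ℕ}

/-! ### From isomorphism classes to numbered digraphs. -/

namespace MultiDigraph

/-- The digraph obtained by renumbering the vertices and the edges. -/
def relabel (G : MultiDigraph) (π : Equiv.Perm (Fin G.nV)) (ρ : Equiv.Perm (Fin G.nE)) :
    MultiDigraph :=
  ⟨G.nV, G.nE, fun e => π (G.src (ρ.symm e)), fun e => π (G.tgt (ρ.symm e))⟩

/-- The isomorphism from a digraph to its renumbering. -/
def relabelIso (G : MultiDigraph) (π : Equiv.Perm (Fin G.nV)) (ρ : Equiv.Perm (Fin G.nE)) :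
    Iso G (G.relabel π ρ) :=
  ⟨π, ρ, fun e => congrArg (fun i => π (G.src i)) (ρ.symm_apply_apply e),
    fun e => congrArg (fun i => π (G.tgt i)) (ρ.symm_apply_apply e)⟩

/-- An isomorphism out of `G` is an arbitrary pair of permutations, which determines its target. -/
theorem bijective_relabel (G : MultiDigraph) :
    Function.Bijective fun p : Equiv.Perm (Fin G.nV) × Equiv.Perm (Fin G.nE) =>
      (⟨G.relabel p.1 p.2, G.relabelIso p.1 p.2⟩ : Σ H, Iso G H) := by
  constructor
  · rintro ⟨π, ρ⟩ ⟨π', ρ'⟩ h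
    have hV := congrArg (fun x : Σ H, Iso G H => fun i => (x.2.onV i : ℕ)) h
    have hE := congrArg (fun x : Σ H, Iso G H => fun i => (x.2.onE i : ℕ)) h
    refine Prod.ext (Equiv.ext fun i => Fin.ext (congrFun hV i))
      (Equiv.ext fun i => Fin.ext (congrFun hE i))
  · rintro ⟨⟨v, e, src, tgt⟩, ⟨π, ρ, h1, h2⟩⟩
    obtain rfl : G.nV = v := by simpa using Fintype.card_congr π
    obtain rfl : G.nE = e := by simpa using Fintype.card_congr ρ
    -- Source and target maps are kept as variables here, so that they can be replaced by the values
    -- which the isomorphism forces.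
    have key : ∀ (src tgt : Fin G.nE → Fin G.nV) (π : Equiv.Perm (Fin G.nV))
        (ρ : Equiv.Perm (Fin G.nE)) (h1 : ∀ e, src (ρ e) = π (G.src e))
        (h2 : ∀ e, tgt (ρ e) = π (G.tgt e)),
        (⟨G.relabel π ρ, G.relabelIso π ρ⟩ : Σ H, Iso G H) =
          ⟨⟨G.nV, G.nE, src, tgt⟩, ⟨π, ρ, h1, h2⟩⟩ := by
      intro src tgt π ρ h1 h2
      obtain rfl : src = fun e => π (G.src (ρ.symm e)) := funext fun e => by
        rw [← h1, ρ.apply_symm_apply]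
      obtain rfl : tgt = fun e => π (G.tgt (ρ.symm e)) := funext fun e => by
        rw [← h2, ρ.apply_symm_apply]
      rfl
    exact ⟨(π, ρ), key src tgt π ρ h1 h2⟩

/-- Orbit-stabiliser: the pairs of a numbered digraph `H` and an isomorphism `G → H` are the
renumberings of `G`. For each such `H`, a chosen isomorphism identifies all of them with `Aut G`. -/
theorem card_isoClass_mul_card_aut (G : MultiDigraph) :
    Nat.card {H : MultiDigraph // Nonempty (Iso G H)} * Nat.card G.Aut =
      G.nV.factorial * G.nE.factorial := by
  have e1 : (Σ H, Iso G H) ≃ {H : MultiDigraph // Nonempty (Iso G H)} × G.Aut :=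
    { toFun := fun x => (⟨x.1, ⟨x.2⟩⟩, x.2.trans (Classical.choice (⟨x.2⟩ : Nonempty _)).symm)
      invFun := fun y => ⟨y.1.1, y.2.trans (Classical.choice y.1.2)⟩
      left_inv := fun x => by
        refine Sigma.ext rfl (heq_of_eq ?_)
        ext <;> simp [Iso.trans, Iso.symm]
      right_inv := fun y => by
        refine Prod.ext rfl ?_
        ext <;> simp [Iso.trans, Iso.symm] }
  rw [← Nat.card_prod, ← Nat.card_congr e1,
    ← Nat.card_congr (Equiv.ofBijective _ G.bijective_relabel), Nat.card_prod]
  simp [Nat.card_eq_fintype_card, Fintype.card_perm]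

theorem Iso.stable {G H : MultiDigraph} (φ : Iso G H) (hG : G.Stable) : H.Stable := fun v => by
  have hin : G.inDeg (φ.onV.symm v) = H.inDeg v :=
    Finset.card_equiv φ.onE fun e => by simp [φ.tgt_comm, Equiv.eq_symm_apply]
  have hout : G.outDeg (φ.onV.symm v) = H.outDeg v :=
    Finset.card_equiv φ.onE fun e => by simp [φ.src_comm, Equiv.eq_symm_apply]
  rw [← hin, ← hout]
  exact hG _

theorem Iso.weight_eq {G H : MultiDigraph} (φ : Iso G H) : G.weight = H.weight := by
  have hV : G.nV = H.nV := by simpa using Fintype.card_congr φ.onV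
  have hE : G.nE = H.nE := by simpa using Fintype.card_congr φ.onE
  rw [weight, weight, hV, hE]

end MultiDigraph

instance (k : ℕ) : Fintype (StableDigraph k) := Fintype.ofFinite _

/-- The isomorphism class of a stable digraph. -/
def StableDigraph.toClass {k : ℕ} (G : StableDigraph k) : StableClass k := Quotient.mk _ G

theorem StableDigraph.nE_eq {k : ℕ} (G : StableDigraph k) : G.1.nE = G.1.nV + k := by
  have := G.2.2
  unfold MultiDigraph.weight at this
  omega

theorem StableDigraph.card_class_mul_card_aut {k : ℕ} (G : StableDigraph k) :
    Nat.card {H : StableDigraph k // H.toClass = G.toClass} * Nat.card G.1.Aut =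
      G.1.nV.factorial * (G.1.nV + k).factorial := by
  rw [← G.nE_eq, ← G.1.card_isoClass_mul_card_aut]
  congr 1
  refine Nat.card_congr ⟨fun H => ⟨H.1.1, Nonempty.map MultiDigraph.Iso.symm (Quotient.exact H.2)⟩,
    fun H => ⟨⟨H.1, H.2.some.stable G.2.1, H.2.some.weight_eq.symm.trans G.2.2⟩,
      Quotient.sound (Nonempty.map MultiDigraph.Iso.symm H.2)⟩, fun H => rfl, fun H => rfl⟩

/-- A sum over isomorphism classes, weighted by the inverse orders of the automorphism groups, is
a sum over labelled digraphs. -/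
theorem sum_stableClass_eq_sum_stableDigraph (Φ : (Fin n → ℂ) → ℝ) (x : Fin n → ℂ) (k : ℕ) :
    ∑ c : StableClass k, (c.coeff : ℂ) * c.weylValue Φ x =
      ∑ G : StableDigraph k, (((G.1.adj - 1).det : ℚ) : ℂ) * G.1.weylValue Φ x /
        ((G.1.nV.factorial : ℂ) * ((G.1.nV + k).factorial : ℂ)) := by
  classical
  rw [← Finset.sum_fiberwise (κ := StableClass k) (s := Finset.univ) (g := StableDigraph.toClass)]
  refine Finset.sum_congr rfl fun c _ => ?_
  have hterm : ∀ G ∈ Finset.univ.filter (fun G : StableDigraph k => G.toClass = c),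
      (((G.1.adj - 1).det : ℚ) : ℂ) * G.1.weylValue Φ x /
        ((G.1.nV.factorial : ℂ) * ((G.1.nV + k).factorial : ℂ)) =
      (c.coeff : ℂ) * c.weylValue Φ x /
        (Finset.univ.filter fun G : StableDigraph k => G.toClass = c).card := by
    intro G hG
    obtain rfl := (Finset.mem_filter.1 hG).2
    have h := G.card_class_mul_card_aut
    rw [Nat.card_eq_fintype_card, Fintype.card_subtype] at h
    have h' : ((Finset.univ.filter fun H : StableDigraph k =>
        H.toClass = G.toClass).card : ℂ) * Nat.card G.1.Aut =
        (G.1.nV.factorial : ℂ) * ((G.1.nV + k).factorial : ℂ) := by exact_mod_cast h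
    have hc : (StableClass.coeff G.toClass) = (G.1.adj - 1).det / (Nat.card G.1.Aut : ℚ) :=
      rfl
    have hw : StableClass.weylValue G.toClass Φ x = G.1.weylValue Φ x := rfl
    rw [hc, hw, ← h']
    rw [Rat.cast_div, Rat.cast_natCast, div_mul_eq_mul_div, div_div, mul_comm (Nat.card G.1.Aut : ℂ)]
  rw [Finset.sum_congr rfl hterm, Finset.sum_const, nsmul_eq_mul, mul_div_cancel₀]
  obtain ⟨G, rfl⟩ := Quotient.exists_rep c
  exact Nat.cast_ne_zero.2 (Finset.card_ne_zero_of_mem (Finset.mem_filter.2 ⟨Finset.mem_univ G, rfl⟩))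

/-- Stability gives `2 v ≤ v + k`, hence `v ≤ k`. The unstable digraphs on the right contribute
zero, which frees the sum from the stability condition. -/
theorem sum_stableDigraph_eq (k : ℕ) (F : MultiDigraph → ℂ) (hF : ∀ G, ¬ G.Stable → F G = 0) :
    ∑ G : StableDigraph k, F G.1 = ∑ v ∈ Finset.range (k + 1),
      ∑ src : Fin (v + k) → Fin v, ∑ tgt : Fin (v + k) → Fin v, F ⟨v, v + k, src, tgt⟩ := by
  classical
  simp only [← Fintype.sum_prod_type' (f := fun src tgt => F ⟨_, _, src, tgt⟩)]
  rw [Finset.sum_sigma']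
  symm
  refine Finset.sum_bij_ne_zero
    (fun p _ hp => (⟨⟨p.1, p.1 + k, p.2.1, p.2.2⟩,
      of_not_not fun hs => hp (hF ⟨_, _, p.2.1, p.2.2⟩ hs), by simp [MultiDigraph.weight]⟩ : StableDigraph k))
    (fun _ _ _ => Finset.mem_univ _) ?_ ?_ (fun _ _ _ => rfl)
  · rintro ⟨v, s, t⟩ _ _ ⟨v', s', t'⟩ _ _ h
    have h' := congrArg Subtype.val h
    simp only [MultiDigraph.mk.injEq] at h'
    obtain ⟨rfl, -, h1, h2⟩ := h'
    rw [eq_of_heq h1, eq_of_heq h2]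
  · rintro ⟨⟨v, e, s, t⟩, hst, hw⟩ - hne
    obtain rfl : e = v + k := by
      simp only [MultiDigraph.weight] at hw
      omega
    have := hst.two_mul_le
    simp only at this
    exact ⟨⟨v, s, t⟩, by simp; omega, hne, rfl⟩

/-- The sum over stable digraphs, in terms of the contractions of the tensors
`t α β = ∂^α ∂̄^β Φ (x)`, where `|α|, |β| ≥ 2`. -/
theorem sum_stableClass_eq (Φ : (Fin n → ℂ) → ℝ) (x : Fin n → ℂ) (hx : metric Φ x = 1) (k : ℕ)
    (t : (Fin n → ℕ) → (Fin n → ℕ) → ℂ)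
    (ht : ∀ α β, ∑ i, α i < 2 ∨ ∑ i, β i < 2 → t α β = 0)
    (htΦ : ∀ α β, 2 ≤ ∑ i, α i → 2 ≤ ∑ i, β i →
      t α β = dzMulti α (dzBarMulti β fun w => (Φ w : ℂ)) x) :
    ∑ c : StableClass k, (c.coeff : ℂ) * c.weylValue Φ x =
      ∑ v ∈ Finset.range (k + 1), (∑ src : Fin (v + k) → Fin v, ∑ tgt : Fin (v + k) → Fin v,
        (adjMat src tgt - 1).det * contraction t src tgt) /
          ((v.factorial : ℂ) * ((v + k).factorial : ℂ)) := by
  have hweyl : ∀ G : MultiDigraph, G.Stable → G.weylValue Φ x = contraction t G.src G.tgt := by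
    intro G hG
    refine Finset.sum_congr rfl fun a _ => ?_
    -- Since the metric at `x` is the identity, the two half-edges of every edge must carry the same
    -- label.
    rw [Finset.sum_eq_single a]
    · rw [Finset.prod_eq_one, one_mul]
      · refine Finset.prod_congr rfl fun v _ => (htΦ _ _ ?_ ?_).symm
        · exact (sum_labelCount G.src a v).symm ▸ (hG v).2
        · exact (sum_labelCount G.tgt a v).symm ▸ (hG v).1
      · intro e _
        simp [invMetric, hx]
    · intro b _ hb
      obtain ⟨e, he⟩ := Function.ne_iff.1 hb
      rw [Finset.prod_eq_zero (Finset.mem_univ e) (by simp [invMetric, hx, he]), zero_mul]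
    · simp
  have hadj : ∀ G : MultiDigraph, (((G.adj - 1).det : ℚ) : ℂ) = (adjMat G.src G.tgt - 1).det := by
    intro G
    rw [show (((G.adj - 1).det : ℚ) : ℂ) = Rat.castHom ℂ (G.adj - 1).det from rfl, RingHom.map_det]
    congr 1
    ext i j
    by_cases h : i = j <;> simp [MultiDigraph.adj, adjMat, h]
  rw [sum_stableClass_eq_sum_stableDigraph]
  have h := sum_stableDigraph_eq k (fun G => (adjMat G.src G.tgt - 1).det *
    contraction t G.src G.tgt / ((G.nV.factorial : ℂ) * ((G.nV + k).factorial : ℂ))) (by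
      intro G hG
      simp only [MultiDigraph.Stable, not_forall, not_and_or, not_le] at hG
      obtain ⟨v, hv⟩ := hG
      rw [contraction_eq_zero ht ⟨v, hv.symm⟩]
      simp)
  rw [Finset.sum_congr rfl fun G _ => by rw [hadj, hweyl G.1 G.2.1], h]
  simp only [Finset.sum_div]

/-! ### Jets of the potential, its extensions and the remainder `S` in normal coordinates. -/

section AbstractJets

variable {A : Type*} [CommRing A] [Algebra ℂ A] {n : ℕ}

/-- The mixed derivative with multi-indices `α` and `β`, evaluated by `ε`. -/
def jet (D D' : Fin n → Derivation ℂ A A) (ε : A →ₐ[ℂ] ℂ) (α β : Fin n → ℕ) (a : A) : ℂ :=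
  ε (multiD D α (multiD D' β a))

theorem exists_eq_add_single {α : Fin n → ℕ} (h : 1 ≤ ∑ i, α i) :
    ∃ (α' : Fin n → ℕ) (i : Fin n), α = α' + Pi.single i 1 ∧ ∑ j, α j = ∑ j, α' j + 1 := by
  obtain ⟨i, -, hi⟩ := Finset.exists_ne_zero_of_sum_ne_zero (Nat.one_le_iff_ne_zero.1 h)
  have hα : α = (α - Pi.single i 1) + Pi.single i 1 := by
    funext j
    by_cases hj : j = i
    · subst hj
      simp
      omega
    · simp [hj]
  refine ⟨_, i, hα, ?_⟩
  conv_lhs => rw [hα]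
  simp [Finset.sum_add_distrib]

theorem eq_zero_of_sum_eq_zero {α : Fin n → ℕ} (h : ∑ i, α i = 0) : α = 0 :=
  funext fun i => Finset.sum_eq_zero_iff.1 h i (Finset.mem_univ i)

theorem multiD_induction {D : Fin n → Derivation ℂ A A} {P : A → Prop}
    (hP : ∀ i a, P a → P (D i a)) (α : Fin n → ℕ) {a : A} (ha : P a) : P (multiD D α a) := by
  unfold multiD
  induction List.finRange n with
  | nil => exact ha
  | cons j l ih =>
    rw [List.foldr_cons]
    generalize α j = m
    induction m with
    | zero => exact ih
    | succ m ihm => rw [Function.iterate_succ_apply']; exact hP _ _ ihm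

variable {D D' : Fin n → Derivation ℂ A A} {ε : A →ₐ[ℂ] ℂ}

theorem jet_add (α β : Fin n → ℕ) (a b : A) :
    jet D D' ε α β (a + b) = jet D D' ε α β a + jet D D' ε α β b := by
  simp only [jet, multiD_add, map_add]

theorem jet_sub (α β : Fin n → ℕ) (a b : A) :
    jet D D' ε α β (a - b) = jet D D' ε α β a - jet D D' ε α β b := by
  simp only [jet, multiD_sub, map_sub]

theorem jet_map_zero (α β : Fin n → ℕ) : jet D D' ε α β 0 = 0 := by
  simp only [jet, multiD_map_zero, map_zero]

theorem jet_zero_zero (a : A) : jet D D' ε 0 0 a = ε a := by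
  simp only [jet, multiD_zero]

theorem jet_add_single_left (hD : ∀ i j a, D i (D j a) = D j (D i a))
    (hDD' : ∀ i j a, D i (D' j a) = D' j (D i a)) (α β : Fin n → ℕ) (i : Fin n) (a : A) :
    jet D D' ε (α + Pi.single i 1) β a = jet D D' ε α β (D i a) := by
  rw [jet, multiD_add_single D hD, multiD_comm D (D i) (fun j a => hD i j a),
    multiD_comm D' (D i) (fun j a => hDD' i j a), jet]

theorem jet_add_single_right (hD' : ∀ i j a, D' i (D' j a) = D' j (D' i a)) (α β : Fin n → ℕ)
    (j : Fin n) (a : A) :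
    jet D D' ε α (β + Pi.single j 1) a = jet D D' ε α β (D' j a) := by
  rw [jet, multiD_add_single D' hD', multiD_comm D' (D' j) (fun i a => hD' j i a), jet]

/-- The jets of a potential `φ`, of its almost analytic extensions `ψ` and `ψ'` in one variable,
and of the coordinates `z` and `z'`, at the centre of a normal coordinate system. -/
structure NormalJets (D D' : Fin n → Derivation ℂ A A) (ε : A →ₐ[ℂ] ℂ) (N : ℕ) (φ ψ ψ' : A)
    (z z' : Fin n → A) : Prop where
  comm : ∀ i j a, D i (D j a) = D j (D i a)
  comm' : ∀ i j a, D' i (D' j a) = D' j (D' i a)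
  comm_mixed : ∀ i j a, D i (D' j a) = D' j (D i a)
  d_coord : ∀ i j, D i (z j) = if i = j then 1 else 0
  d_coord' : ∀ i j, D i (z' j) = 0
  dbar_coord : ∀ i j, D' i (z j) = 0
  dbar_coord' : ∀ i j, D' i (z' j) = if i = j then 1 else 0
  eval_coord : ∀ i, ε (z i) = 0
  eval_coord' : ∀ i, ε (z' i) = 0
  metric_eq : ∀ i j, ε (D i (D' j φ)) = if i = j then 1 else 0
  holo : ∀ i j α, 1 ≤ ∑ l, α l → ∑ l, α l ≤ N → jet D D' ε α 0 (D i (D' j φ)) = 0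
  antiholo : ∀ i j β, 1 ≤ ∑ l, β l → ∑ l, β l ≤ N → jet D D' ε 0 β (D i (D' j φ)) = 0
  ext_holo : ∀ α β, 1 ≤ ∑ l, α l → jet D D' ε α β ψ = 0
  ext_antiholo : ∀ β, jet D D' ε 0 β ψ = jet D D' ε 0 β φ
  ext_antiholo' : ∀ α β, 1 ≤ ∑ l, β l → jet D D' ε α β ψ' = 0
  ext_holo' : ∀ α, jet D D' ε α 0 ψ' = jet D D' ε α 0 φ

namespace NormalJets

variable {N : ℕ} {φ ψ ψ' : A} {z z' : Fin n → A}

/-- The part of the jet of the potential of bidegree at least `(2, 2)`. -/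
def tensor (D D' : Fin n → Derivation ℂ A A) (ε : A →ₐ[ℂ] ℂ) (φ : A) (α β : Fin n → ℕ) : ℂ :=
  if 2 ≤ ∑ i, α i ∧ 2 ≤ ∑ i, β i then jet D D' ε α β φ else 0

theorem jet_left (H : NormalJets D D' ε N φ ψ ψ' z z') (α β : Fin n → ℕ) (i : Fin n) (a : A) :
    jet D D' ε (α + Pi.single i 1) β a = jet D D' ε α β (D i a) :=
  jet_add_single_left H.comm H.comm_mixed α β i a

theorem jet_right (H : NormalJets D D' ε N φ ψ ψ' z z') (α β : Fin n → ℕ) (j : Fin n) (a : A) :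
    jet D D' ε α (β + Pi.single j 1) a = jet D D' ε α β (D' j a) :=
  jet_add_single_right H.comm' α β j a

theorem jet_const (H : NormalJets D D' ε N φ ψ ψ' z z') (α β : Fin n → ℕ)
    (h : 1 ≤ ∑ i, α i ∨ 1 ≤ ∑ i, β i) (c : ℂ) : jet D D' ε α β (algebraMap ℂ A c) = 0 := by
  rcases h with h | h
  · obtain ⟨α, i, rfl, -⟩ := exists_eq_add_single h
    rw [H.jet_left, Derivation.map_algebraMap, jet_map_zero]
  · obtain ⟨β, i, rfl, -⟩ := exists_eq_add_single h
    rw [H.jet_right, Derivation.map_algebraMap, jet_map_zero]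

theorem jet_delta (H : NormalJets D D' ε N φ ψ ψ' z z') (α β : Fin n → ℕ)
    (h : 1 ≤ ∑ i, α i ∨ 1 ≤ ∑ i, β i) (p : Prop) [Decidable p] :
    jet D D' ε α β (if p then 1 else 0) = 0 := by
  split_ifs
  · simpa using H.jet_const α β h 1
  · exact jet_map_zero α β

theorem d_quad (H : NormalJets D D' ε N φ ψ ψ' z z') (i : Fin n) : D i (∑ j, z j * z' j) = z' i := by
  simp [H.d_coord, H.d_coord']

theorem dbar_quad (H : NormalJets D D' ε N φ ψ ψ' z z') (i : Fin n) :
    D' i (∑ j, z j * z' j) = z i := by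
  simp [H.dbar_coord, H.dbar_coord']

/-- The remainder in the expansion of the diastatic function. -/
def remainder (ε : A →ₐ[ℂ] ℂ) (φ ψ ψ' : A) (z z' : Fin n → A) : A :=
  (∑ j, z j * z' j) - (algebraMap ℂ A (ε φ) + φ - ψ - ψ')

theorem jet_remainder_eq (φ ψ ψ' : A) (z z' : Fin n → A) (α β : Fin n → ℕ) :
    jet D D' ε α β (remainder ε φ ψ ψ' z z') = jet D D' ε α β (∑ j, z j * z' j) -
      (jet D D' ε α β (algebraMap ℂ A (ε φ)) + jet D D' ε α β φ - jet D D' ε α β ψ -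
        jet D D' ε α β ψ') := by
  simp only [remainder, jet_add, jet_sub]

/-- In pure directions of positive order one of `ψ`, `ψ'` has the jets of `φ` and the other has
none, so the diastatic function has no pure jets; at order zero its four values cancel. A single
derivative of `∑ z_j z'_j` leaves a coordinate, which vanishes at the centre and has no derivatives
of the type in question. -/
theorem jet_pure (H : NormalJets D D' ε N φ ψ ψ' z z') (α β : Fin n → ℕ)
    (h : ∑ i, α i = 0 ∨ ∑ i, β i = 0) : jet D D' ε α β (remainder ε φ ψ ψ' z z') = 0 := by
  rw [jet_remainder_eq]
  by_cases h0 : ∑ i, α i = 0 ∧ ∑ i, β i = 0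
  · rw [eq_zero_of_sum_eq_zero h0.1, eq_zero_of_sum_eq_zero h0.2, H.ext_antiholo, H.ext_holo',
      jet_zero_zero, jet_zero_zero, jet_zero_zero]
    simp [H.eval_coord]
  · rcases h with h | h
    · have hβ : 1 ≤ ∑ i, β i := by omega
      rw [eq_zero_of_sum_eq_zero h, H.ext_antiholo, H.ext_antiholo' _ _ hβ,
        H.jet_const _ _ (Or.inr hβ)]
      obtain ⟨β, j, rfl, -⟩ := exists_eq_add_single hβ
      rw [H.jet_right, H.jet_right, H.dbar_quad]
      have : jet D D' ε 0 β (z j) = 0 := by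
        by_cases hb : ∑ i, β i = 0
        · rw [eq_zero_of_sum_eq_zero hb, jet_zero_zero, H.eval_coord]
        · obtain ⟨β, i, rfl, -⟩ := exists_eq_add_single (Nat.one_le_iff_ne_zero.2 hb)
          rw [H.jet_right, H.dbar_coord, jet_map_zero]
      rw [this]
      ring
    · have hα : 1 ≤ ∑ i, α i := by omega
      rw [eq_zero_of_sum_eq_zero h, H.ext_holo', H.ext_holo _ _ hα, H.jet_const _ _ (Or.inl hα)]
      obtain ⟨α, j, rfl, -⟩ := exists_eq_add_single hα
      rw [H.jet_left, H.jet_left, H.d_quad]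
      have : jet D D' ε α 0 (z' j) = 0 := by
        by_cases hb : ∑ i, α i = 0
        · rw [eq_zero_of_sum_eq_zero hb, jet_zero_zero, H.eval_coord']
        · obtain ⟨α, i, rfl, -⟩ := exists_eq_add_single (Nat.one_le_iff_ne_zero.2 hb)
          rw [H.jet_left, H.d_coord', jet_map_zero]
      rw [this]
      ring

/-- When `α` and `β` are both nonzero, this is a jet of `φ` of bidegree at least `(2, 2)`. If
exactly one is zero, the jet vanishes by normality, which is where `k ≤ N` is used; if both are, the
metric cancels against the identity. -/
theorem jet_metric_sub_delta (H : NormalJets D D' ε N φ ψ ψ' z z') {k : ℕ} (hk : k ≤ N)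
    (i j : Fin n) (α β : Fin n → ℕ) (hα : ∑ i, α i ≤ k) (hβ : ∑ i, β i ≤ k) :
    jet D D' ε α β (D i (D' j φ) - if i = j then 1 else 0) =
      tensor D D' ε φ (α + Pi.single i 1) (β + Pi.single j 1) := by
  have hs : ∀ (γ : Fin n → ℕ) (l : Fin n),
      ∑ m, (γ + Pi.single l 1 : Fin n → ℕ) m = ∑ m, γ m + 1 := fun γ l => by
    simp [Finset.sum_add_distrib]
  rw [tensor, hs, hs, jet_sub]
  by_cases h : ∑ i, α i = 0 ∧ ∑ i, β i = 0
  · have h2 : ¬(2 ≤ ∑ m, α m + 1 ∧ 2 ≤ ∑ m, β m + 1) := by omega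
    rw [if_neg h2, eq_zero_of_sum_eq_zero h.1,
      eq_zero_of_sum_eq_zero h.2, jet_zero_zero, jet_zero_zero, H.metric_eq, apply_ite ε, map_one,
      map_zero, sub_self]
  · rw [H.jet_delta _ _ (by omega), sub_zero]
    split_ifs with h2
    · rw [H.jet_left, H.jet_right, H.comm_mixed]
    · by_cases h3 : ∑ i, α i = 0
      · rw [eq_zero_of_sum_eq_zero h3, H.antiholo _ _ _ (by omega) (by omega)]
      · have h4 : ∑ i, β i = 0 := by omega
        rw [eq_zero_of_sum_eq_zero h4, H.holo _ _ _ (by omega) (by omega)]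

/-- In mixed directions `ψ` and `ψ'` drop out, and one derivative of each type turns `∑ z_j z'_j -
φ` into `δ - g`. Hence the orders may be one higher than in `jet_metric_sub_delta`. -/
theorem jet_remainder (H : NormalJets D D' ε N φ ψ ψ' z z') {k : ℕ} (hk : k ≤ N)
    (α β : Fin n → ℕ) (hα : ∑ i, α i ≤ k + 1) (hβ : ∑ i, β i ≤ k + 1) :
    jet D D' ε α β (remainder ε φ ψ ψ' z z') = -tensor D D' ε φ α β := by
  by_cases h : ∑ i, α i = 0 ∨ ∑ i, β i = 0
  · rw [H.jet_pure _ _ h, tensor, if_neg (by omega), neg_zero]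
  · rw [jet_remainder_eq, H.ext_holo _ _ (by omega), H.ext_antiholo' _ _ (by omega),
      H.jet_const _ _ (by omega)]
    obtain ⟨α, i, rfl, h1⟩ := exists_eq_add_single (α := α) (by omega)
    obtain ⟨β, j, rfl, h2⟩ := exists_eq_add_single (α := β) (by omega)
    rw [← H.jet_metric_sub_delta hk i j α β (by omega) (by omega), H.jet_left, H.jet_right,
      ← H.comm_mixed, H.dbar_quad, H.d_coord, H.jet_left, H.jet_right, ← H.comm_mixed, jet_sub]
    ring

theorem jetData (H : NormalJets D D' ε N φ ψ ψ' z z') {k : ℕ} (hk : k ≤ N) :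
    JetData D D' ε (tensor D D' ε φ) k
      (Matrix.of fun i j => D i (D' j φ) - if i = j then 1 else 0) (remainder ε φ ψ ψ' z z') where
  comm := H.comm
  comm' := H.comm'
  comm_mixed := H.comm_mixed
  vanish α β h := if_neg (by omega)
  jet_pure := H.jet_pure
  jet_remainder := H.jet_remainder hk
  jet_metric := H.jet_metric_sub_delta hk

end NormalJets

end AbstractJets

/-! ### Coordinate derivations and their agreement with the concrete derivatives. -/

section Coordinates

variable {O : Opens (Fin n → ℂ)}

/-- `∂ / ∂ z_i` as a derivation. -/
def dzD (O : Opens (Fin n → ℂ)) (i : Fin n) : Derivation ℂ (smoothAlg O) (smoothAlg O) :=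
  wirtD O (Pi.single i 1)

/-- `∂ / ∂ \bar z_i` as a derivation. -/
def dzBarD (O : Opens (Fin n → ℂ)) (i : Fin n) : Derivation ℂ (smoothAlg O) (smoothAlg O) :=
  wirtBarD O (Pi.single i 1)

theorem Rep.dzD {a : smoothAlg O} {F : (Fin n → ℂ) → ℂ} (h : Rep a F) (i : Fin n) :
    Rep (dzD O i a) (dz i F) := h.wirtD _

theorem Rep.dzBarD {a : smoothAlg O} {F : (Fin n → ℂ) → ℂ} (h : Rep a F) (i : Fin n) :
    Rep (dzBarD O i a) (dzBar i F) := h.wirtBarD _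

theorem Rep.iterate {a : smoothAlg O} {F : (Fin n → ℂ) → ℂ} (h : Rep a F)
    {T : smoothAlg O → smoothAlg O} {T' : ((Fin n → ℂ) → ℂ) → (Fin n → ℂ) → ℂ}
    (hT : ∀ {a F}, Rep a F → Rep (T a) (T' F)) (m : ℕ) : Rep (T^[m] a) (T'^[m] F) := by
  induction m with
  | zero => exact h
  | succ m ih =>
    rw [Function.iterate_succ_apply', Function.iterate_succ_apply']
    exact hT ih

theorem Rep.dzMulti {a : smoothAlg O} {F : (Fin n → ℂ) → ℂ} (h : Rep a F) (α : Fin n → ℕ) :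
    Rep (multiD (BerezinGraph.dzD O) α a) (dzMulti α F) := by
  unfold multiD BerezinGraph.dzMulti
  induction List.finRange n with
  | nil => exact h
  | cons j l ih => exact ih.iterate (fun h => h.dzD j) _

theorem Rep.dzBarMulti {a : smoothAlg O} {F : (Fin n → ℂ) → ℂ} (h : Rep a F) (β : Fin n → ℕ) :
    Rep (multiD (BerezinGraph.dzBarD O) β a) (dzBarMulti β F) := by
  unfold multiD BerezinGraph.dzBarMulti
  induction List.finRange n with
  | nil => exact h
  | cons j l ih => exact ih.iterate (fun h => h.dzBarD j) _

theorem Rep.flatLaplacian {a : smoothAlg O} {F : (Fin n → ℂ) → ℂ} (h : Rep a F)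
    {Φ : (Fin n → ℂ) → ℝ} {x : Fin n → ℂ} (hx : metric Φ x = 1) :
    Rep (BerezinGraph.flatLaplacian (BerezinGraph.dzD O) (BerezinGraph.dzBarD O) a) (frozenLaplacian Φ x F) := by
  have h1 := Rep.sum (s := Finset.univ) fun i _ => (h.dzBarD i).dzD i
  intro p
  refine (h1 p).trans (Finset.sum_congr rfl fun i _ => ?_)
  rw [Finset.sum_eq_single i]
  · simp [invMetric, hx]
  · intro j _ hj
    simp [invMetric, hx, hj]
  · simp

theorem Rep.det {M : Matrix (Fin n) (Fin n) (smoothAlg O)}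
    {F : (Fin n → ℂ) → Matrix (Fin n) (Fin n) ℂ} (h : ∀ i j, Rep (M i j) fun z => F z i j) :
    Rep M.det fun z => (F z).det := fun p => by
  rw [← evalHom_apply, AlgHom.map_det]
  congr 1
  ext i j
  exact h i j p

/-- The function `y ↦ y_j - x_j`. -/
def coordFun (x : Fin n → ℂ) (j : Fin n) (y : Fin n → ℂ) : ℂ := y j - x j

/-- The function `y ↦ conj (y_j - x_j)`. -/
def coordBarFun (x : Fin n → ℂ) (j : Fin n) (y : Fin n → ℂ) : ℂ := starRingEnd ℂ (y j - x j)

theorem hasFDerivAt_coordFun (x : Fin n → ℂ) (j : Fin n) (p : Fin n → ℂ) :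
    HasFDerivAt (coordFun x j) (ContinuousLinearMap.proj (R := ℝ) (φ := fun _ : Fin n => ℂ) j) p :=
  (hasFDerivAt_apply j p).sub_const _

theorem hasFDerivAt_coordBarFun (x : Fin n → ℂ) (j : Fin n) (p : Fin n → ℂ) :
    HasFDerivAt (coordBarFun x j) ((Complex.conjCLE : ℂ →L[ℝ] ℂ).comp
      (ContinuousLinearMap.proj (R := ℝ) (φ := fun _ : Fin n => ℂ) j)) p :=
  (Complex.conjCLE : ℂ →L[ℝ] ℂ).hasFDerivAt.comp p (hasFDerivAt_coordFun x j p)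

theorem contDiff_coordFun (x : Fin n → ℂ) (j : Fin n) : ContDiff ℝ ∞ (coordFun x j) := by
  unfold coordFun
  fun_prop

theorem contDiff_coordBarFun (x : Fin n → ℂ) (j : Fin n) : ContDiff ℝ ∞ (coordBarFun x j) :=
  Complex.conjCLE.contDiff.comp (contDiff_coordFun x j)

theorem dz_coordFun (x : Fin n → ℂ) (i j : Fin n) (p : Fin n → ℂ) :
    dz i (coordFun x j) p = if i = j then 1 else 0 := by
  simp only [dz, wirt, (hasFDerivAt_coordFun x j p).fderiv, ContinuousLinearMap.proj_apply,
    Pi.smul_apply, Pi.single_apply, smul_eq_mul, eq_comm (a := j)]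
  split_ifs
  · rw [mul_one, Complex.I_mul_I]; norm_num
  · simp

theorem dzBar_coordFun (x : Fin n → ℂ) (i j : Fin n) (p : Fin n → ℂ) :
    dzBar i (coordFun x j) p = 0 := by
  simp only [dzBar, wirtBar, (hasFDerivAt_coordFun x j p).fderiv, ContinuousLinearMap.proj_apply,
    Pi.smul_apply, Pi.single_apply, smul_eq_mul, eq_comm (a := j)]
  split_ifs
  · rw [mul_one, Complex.I_mul_I]; norm_num
  · simp

theorem dz_coordBarFun (x : Fin n → ℂ) (i j : Fin n) (p : Fin n → ℂ) :
    dz i (coordBarFun x j) p = 0 := by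
  simp only [dz, wirt, (hasFDerivAt_coordBarFun x j p).fderiv, ContinuousLinearMap.proj_apply,
    ContinuousLinearMap.comp_apply, Pi.smul_apply, Pi.single_apply, smul_eq_mul, eq_comm (a := j),
    ContinuousLinearEquiv.coe_coe, Complex.conjCLE_apply]
  split_ifs <;> simp

theorem dzBar_coordBarFun (x : Fin n → ℂ) (i j : Fin n) (p : Fin n → ℂ) :
    dzBar i (coordBarFun x j) p = if i = j then 1 else 0 := by
  simp only [dzBar, wirtBar, (hasFDerivAt_coordBarFun x j p).fderiv,
    ContinuousLinearMap.proj_apply, ContinuousLinearMap.comp_apply, Pi.smul_apply, Pi.single_apply,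
    smul_eq_mul, eq_comm (a := j), ContinuousLinearEquiv.coe_coe, Complex.conjCLE_apply]
  split_ifs
  · simp; norm_num
  · simp

end Coordinates

/-! ### Jets of the almost analytic extension along slices and along the diagonal. -/

section Extension

variable {O : Opens (Fin n → ℂ)} {W : Opens ((Fin n → ℂ) × (Fin n → ℂ))} {p : O} {q : W}

theorem IsPullback.eval_eq {ι : (Fin n → ℂ) → (Fin n → ℂ) × (Fin n → ℂ)} {a : smoothAlg O}
    {b : smoothAlg W} (h : IsPullback ι a b) (hq : (q : (Fin n → ℂ) × (Fin n → ℂ)) = ι p) :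
    evalHom p a = evalHom q b := by
  obtain ⟨q', hq', hab⟩ := h p
  rw [hab, Subtype.ext (hq'.trans hq.symm)]

/-- Derivatives of the pullback are pullbacks of derivatives, and these remain flat at `q`. -/
theorem IsPullback.jet_eq_zero {ι : (Fin n → ℂ) → (Fin n → ℂ) × (Fin n → ℂ)}
    {L : (Fin n → ℂ) →L[ℂ] (Fin n → ℂ) × (Fin n → ℂ)}
    (hι : ∀ z, HasFDerivAt ι (L.restrictScalars ℝ) z)
    (hq : (q : (Fin n → ℂ) × (Fin n → ℂ)) = ι p) {a : smoothAlg O} {b : smoothAlg W}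
    (h : IsPullback ι a b) (hb : Flat q b) (α β : Fin n → ℕ) :
    jet (dzD O) (dzBarD O) (evalHom p) α β a = 0 := by
  let P : smoothAlg O → Prop := fun a => ∃ c : smoothAlg W, IsPullback ι a c ∧ Flat q c
  have h1 : P (multiD (dzBarD O) β a) := multiD_induction (fun i a ha => by
    obtain ⟨c, h, hc⟩ := ha
    exact ⟨_, h.wirtBarD hι _, hc.wirtBarD _⟩) β ⟨b, h, hb⟩
  have h2 : P (multiD (dzD O) α (multiD (dzBarD O) β a)) := multiD_induction (fun i a ha => by
    obtain ⟨c, h, hc⟩ := ha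
    exact ⟨_, h.wirtD hι _, hc.wirtD _⟩) α h1
  obtain ⟨c, h, hc⟩ := h2
  exact (h.eval_eq hq).trans hc.eval

theorem Flat.sub {a b : smoothAlg W} (ha : Flat q a) (hb : Flat q b) : Flat q (a - b) := by
  have := ha.add (hb.smul (-1))
  rwa [neg_one_smul, ← sub_eq_add_neg] at this

theorem multiD_induction_pair {A : Type*} [CommRing A] [Algebra ℂ A]
    {D : Fin n → Derivation ℂ A A} {P : A → A → Prop}
    (hP : ∀ i a b, P a b → P (D i a) (D i b)) (α : Fin n → ℕ) {a b : A} (hab : P a b) :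
    P (multiD D α a) (multiD D α b) := by
  unfold multiD
  induction List.finRange n with
  | nil => exact hab
  | cons j l ih =>
    rw [List.foldr_cons, List.foldr_cons]
    generalize α j = m
    induction m with
    | zero => exact ih
    | succ m ihm =>
      rw [Function.iterate_succ_apply', Function.iterate_succ_apply']
      exact hP _ _ _ ihm

/-- If the derivatives of `b` in the directions `L₀ v` vanish to infinite order, then the
derivatives of its pullbacks along maps with linear parts `L₁` and `L₁ + L₀` agree. Here `T` and
`T₀` stand for the holomorphic or for the antiholomorphic Wirtinger derivatives. -/
theorem eval_multiD_pullback_eq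
    {T : (Fin n → ℂ) × (Fin n → ℂ) → Derivation ℂ (smoothAlg W) (smoothAlg W)}
    {T₀ : Fin n → Derivation ℂ (smoothAlg O) (smoothAlg O)}
    {ι₁ ι₂ : (Fin n → ℂ) → (Fin n → ℂ) × (Fin n → ℂ)} {L₀ L₁ : Fin n → (Fin n → ℂ) × (Fin n → ℂ)}
    (hT_add : ∀ v w b, T (v + w) b = T v b + T w b)
    (hT_comm : ∀ v w b, T v (T w b) = T w (T v b))
    (hT_flat : ∀ v b, Flat q b → Flat q (T v b))
    (h₁ : ∀ a b i, IsPullback ι₁ a b → IsPullback ι₁ (T₀ i a) (T (L₁ i) b))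
    (h₂ : ∀ a b i, IsPullback ι₂ a b → IsPullback ι₂ (T₀ i a) (T (L₁ i + L₀ i) b))
    (hq₁ : (q : (Fin n → ℂ) × (Fin n → ℂ)) = ι₁ p) (hq₂ : (q : (Fin n → ℂ) × (Fin n → ℂ)) = ι₂ p)
    {a₁ a₂ : smoothAlg O} {b : smoothAlg W} (ha₁ : IsPullback ι₁ a₁ b) (ha₂ : IsPullback ι₂ a₂ b)
    (hb : ∀ i, Flat q (T (L₀ i) b)) (α : Fin n → ℕ) :
    evalHom p (multiD T₀ α a₁) = evalHom p (multiD T₀ α a₂) := by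
  -- After differentiation the two functions are pullbacks of different `c₁` and `c₂`. The invariant
  -- is that these differ by a flat function and that the `L₀` derivatives of `c₁` stay flat, which
  -- controls the next discrepancy.
  let P : smoothAlg O → smoothAlg O → Prop := fun a₁ a₂ => ∃ c₁ c₂ : smoothAlg W,
    IsPullback ι₁ a₁ c₁ ∧ IsPullback ι₂ a₂ c₂ ∧ Flat q (c₁ - c₂) ∧ ∀ i, Flat q (T (L₀ i) c₁)
  have hzero : Flat q (b - b) := by
    have h0 : Rep (b - b) (fun _ => 0) := fun r => by rw [sub_self]; rfl
    exact (h0.flat_iff q).2 fun m => by simp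
  have h : P (multiD T₀ α a₁) (multiD T₀ α a₂) := multiD_induction_pair (fun i a a' ha => by
    obtain ⟨c₁, c₂, hc₁, hc₂, hf, hv⟩ := ha
    refine ⟨_, _, h₁ _ _ i hc₁, h₂ _ _ i hc₂, ?_, fun j => ?_⟩
    · have he : T (L₁ i) c₁ - T (L₁ i + L₀ i) c₂ =
          (T (L₁ i) (c₁ - c₂) + T (L₀ i) (c₁ - c₂)) - T (L₀ i) c₁ := by
        rw [hT_add, Derivation.map_sub, Derivation.map_sub]
        abel
      rw [he]
      exact ((hT_flat _ _ hf).add (hT_flat _ _ hf)).sub (hv i)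
    · rw [hT_comm]
      exact hT_flat _ _ (hv j)) α ⟨b, b, ha₁, ha₂, hzero, hb⟩
  obtain ⟨c₁, c₂, hc₁, hc₂, hf, -⟩ := h
  rw [hc₁.eval_eq hq₁, hc₂.eval_eq hq₂, ← sub_eq_zero, ← map_sub, hf.eval]

end Extension

/-- The data of the Kähler potential, of its almost analytic extension and of the coordinates,
realised in the algebra of smooth functions near the centre of a normal coordinate system. -/
theorem exists_normalJets {Ω : Set (Fin n → ℂ)} {Φ : (Fin n → ℂ) → ℝ}
    (hΦ : IsKahlerPotential Ω Φ) {U : Set ((Fin n → ℂ) × (Fin n → ℂ))}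
    {Ψ : (Fin n → ℂ) × (Fin n → ℂ) → ℂ} (hΨ : IsAlmostAnalyticExtension Ω Φ U Ψ)
    {x : Fin n → ℂ} (hx : x ∈ Ω) {N : ℕ} (hN : IsNormalAt Φ x N) :
    ∃ (O : Opens (Fin n → ℂ)) (p : O) (φ ψ ψ' : smoothAlg O) (z z' : Fin n → smoothAlg O),
      (p : Fin n → ℂ) = x ∧ Rep φ (fun w => (Φ w : ℂ)) ∧ Rep ψ (fun y => Ψ (x, y)) ∧
      Rep ψ' (fun y => Ψ (y, x)) ∧ (∀ j, Rep (z j) (coordFun x j)) ∧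
      (∀ j, Rep (z' j) (coordBarFun x j)) ∧
      NormalJets (dzD O) (dzBarD O) (evalHom p) N φ ψ ψ' z z' := by
  let W : Opens ((Fin n → ℂ) × (Fin n → ℂ)) := ⟨U, hΨ.isOpen⟩
  let O : Opens (Fin n → ℂ) := ⟨Ω ∩ (fun y => (x, y)) ⁻¹' U,
    hΦ.isOpen.inter (hΨ.isOpen.preimage (by fun_prop))⟩
  let p : O := ⟨x, hx, hΨ.diag_mem x hx⟩
  let q : W := ⟨(x, x), hΨ.diag_mem x hx⟩
  -- The Hermitian symmetry of the extension includes the symmetry of `U`, so the other slice is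
  -- also defined on `O`.
  have hOU : ∀ y : O, ((y : Fin n → ℂ), x) ∈ U := fun y => (hΨ.symm _ y.2.2).1
  obtain ⟨b, hb⟩ := exists_rep (O := W) hΨ.smooth
  obtain ⟨φ, hφ⟩ := exists_rep (O := O) (F := fun w => (Φ w : ℂ))
    (Complex.ofRealCLM.contDiff.comp_contDiffOn (hΦ.smooth.mono fun _ h => h.1))
  obtain ⟨ψ, hψ⟩ := exists_rep (O := O) (F := fun y => Ψ (x, y))
    (hΨ.smooth.comp (contDiff_prodMk_right x).contDiffOn fun _ h => h.2)
  obtain ⟨ψ', hψ'⟩ := exists_rep (O := O) (F := fun y => Ψ (y, x))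
    (hΨ.smooth.comp (contDiff_prodMk_left x).contDiffOn fun y h => hOU ⟨y, h⟩)
  choose z hz using fun j => exists_rep (O := O) (contDiff_coordFun x j).contDiffOn
  choose z' hz' using fun j => exists_rep (O := O) (contDiff_coordBarFun x j).contDiffOn
  have pb : IsPullback (fun y => (x, y)) ψ b := fun y => ⟨⟨(x, y), y.2.2⟩, rfl, (hψ y).trans (hb ⟨(x, y), y.2.2⟩).symm⟩
  have pb' : IsPullback (fun y => (y, x)) ψ' b := fun y => ⟨⟨(y, x), hOU y⟩, rfl, (hψ' y).trans (hb ⟨(y, x), hOU y⟩).symm⟩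
  have pbd : IsPullback (fun y => (y, y)) φ b := fun y => ⟨⟨_, hΨ.diag_mem y y.2.1⟩, rfl,
    (hφ y).trans ((hΨ.diag_eq y y.2.1).symm.trans (hb ⟨_, hΨ.diag_mem y y.2.1⟩).symm)⟩
  have hι : ∀ y, HasFDerivAt (fun y => (x, y))
      ((ContinuousLinearMap.inr ℂ (Fin n → ℂ) (Fin n → ℂ)).restrictScalars ℝ) y := fun y =>
    hasFDerivAt_prodMk_right x y
  have hι' : ∀ y, HasFDerivAt (fun y => (y, x))
      ((ContinuousLinearMap.inl ℂ (Fin n → ℂ) (Fin n → ℂ)).restrictScalars ℝ) y := fun y =>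
    hasFDerivAt_prodMk_left y x
  have hιd : ∀ y, HasFDerivAt (fun y => (y, y)) (((ContinuousLinearMap.id ℂ (Fin n → ℂ)).prod
      (ContinuousLinearMap.id ℂ (Fin n → ℂ))).restrictScalars ℝ) y := fun y =>
    (hasFDerivAt_id y).prodMk (hasFDerivAt_id y)
  have flat : ∀ i, Flat q (wirtD W (0, Pi.single i 1) b) := fun i =>
    ((hb.wirtD _).flat_iff q).2 (hΨ.d_snd x hx i)
  have flat' : ∀ i, Flat q (wirtBarD W (Pi.single i 1, 0) b) := fun i =>
    ((hb.wirtBarD _).flat_iff q).2 (hΨ.dbar_fst x hx i)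
  have comm : ∀ i j a, dzD O i (dzD O j a) = dzD O j (dzD O i a) := fun i j a =>
    wirtD_comm _ _ a
  have comm' : ∀ i j a, dzBarD O i (dzBarD O j a) = dzBarD O j (dzBarD O i a) := fun i j a =>
    wirtBarD_comm _ _ a
  have comm_mixed : ∀ i j a, dzD O i (dzBarD O j a) = dzBarD O j (dzD O i a) := fun i j a =>
    wirtD_wirtBarD_comm _ _ a
  have hmetric : ∀ i j, Rep (dzD O i (dzBarD O j φ)) fun w => metric Φ w i j := fun i j =>
    (hφ.dzBarD j).dzD i
  refine ⟨O, p, φ, ψ, ψ', z, z', rfl, hφ, hψ, hψ', hz, hz', ?_⟩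
  constructor
  · exact comm
  · exact comm'
  · exact comm_mixed
  · intro i j
    refine smoothAlg_ext fun r => ?_
    rw [((hz j).dzD i).evalHom, dz_coordFun, apply_ite (evalHom r), map_one, map_zero]
  · intro i j
    refine smoothAlg_ext fun r => ?_
    rw [((hz' j).dzD i).evalHom, dz_coordBarFun, map_zero]
  · intro i j
    refine smoothAlg_ext fun r => ?_
    rw [((hz j).dzBarD i).evalHom, dzBar_coordFun, map_zero]
  · intro i j
    refine smoothAlg_ext fun r => ?_
    rw [((hz' j).dzBarD i).evalHom, dzBar_coordBarFun, apply_ite (evalHom r), map_one, map_zero]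
  · intro i
    rw [(hz i).evalHom]
    exact sub_self _
  · intro i
    rw [(hz' i).evalHom]
    exact (congrArg (starRingEnd ℂ) (sub_self _)).trans (map_zero _)
  · intro i j
    rw [(hmetric i j).evalHom, show metric Φ p = 1 from hN.metric_eq, Matrix.one_apply]
  · intro i j α h1 h2
    rw [jet, multiD_zero, ((hmetric i j).dzMulti α).evalHom]
    exact hN.holo i j α h1 h2
  · intro i j β h1 h2
    rw [jet, multiD_zero, ((hmetric i j).dzBarMulti β).evalHom]
    exact hN.antiholo i j β h1 h2
  -- On the slice `y ↦ (x, y)` the holomorphic derivative is `∂_y Ψ`, which is flat at `(x, x)`.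
  · intro α β hα
    obtain ⟨α, i, rfl, -⟩ := exists_eq_add_single hα
    rw [jet_add_single_left comm comm_mixed]
    exact (pb.wirtD hι (Pi.single i 1)).jet_eq_zero hι (q := q) rfl (flat i) α β
  -- The slice `y ↦ (x, y)` is compared with the diagonal `y ↦ (y, y)`, along which `Ψ` is `Φ`.
  -- Their linear parts differ in the first variable, where `∂̄_x Ψ` is flat.
  · intro β
    rw [jet, jet, multiD_zero, multiD_zero]
    refine eval_multiD_pullback_eq (q := q) (T := wirtBarD W) (L₀ := fun i => (Pi.single i 1, 0))
      (L₁ := fun i => (0, Pi.single i 1)) (fun v w b => wirtBarD_add v w b)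
      (fun v w b => wirtBarD_comm v w b) (fun v b h => h.wirtBarD v)
      (fun a b i h => h.wirtBarD hι (Pi.single i 1)) (fun a b i h => ?_) rfl rfl pb pbd flat' β
    have := h.wirtBarD hιd (Pi.single i 1)
    simpa using this
  · intro α β hβ
    obtain ⟨β, i, rfl, -⟩ := exists_eq_add_single hβ
    rw [jet_add_single_right comm']
    exact (pb'.wirtBarD hι' (Pi.single i 1)).jet_eq_zero hι' (q := q) rfl (flat' i) α β
  · intro α
    rw [jet, jet, multiD_zero, multiD_zero]
    refine eval_multiD_pullback_eq (q := q) (T := wirtD W) (L₀ := fun i => (0, Pi.single i 1))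
      (L₁ := fun i => (Pi.single i 1, 0)) (fun v w b => wirtD_add v w b)
      (fun v w b => wirtD_comm v w b) (fun v b h => h.wirtD v)
      (fun a b i h => h.wirtD hι' (Pi.single i 1)) (fun a b i h => ?_) rfl rfl pb' pbd flat α
    have := h.wirtD hιd (Pi.single i 1)
    simpa using this

/-! ### Comparison of the two sides. -/

theorem scalarInvariant_zero {Ω : Set (Fin n → ℂ)} {Φ : (Fin n → ℂ) → ℝ}
    (hΦ : IsKahlerPotential Ω Φ) (Ψ : (Fin n → ℂ) × (Fin n → ℂ) → ℂ) {x : Fin n → ℂ}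
    (hx : x ∈ Ω) : scalarInvariant Φ Ψ 0 x = 1 := by
  have h : (metric Φ x).det ≠ 0 := (hΦ.posDef x hx).det_pos.ne'
  -- For `k = 0` only `m = 0` occurs, and the quotient is `det g / det g`.
  simp [scalarInvariant, englisR, h]

theorem scalarInvariant_eq_sum {Ω : Set (Fin n → ℂ)} {Φ : (Fin n → ℂ) → ℝ}
    (hΦ : IsKahlerPotential Ω Φ) {U : Set ((Fin n → ℂ) × (Fin n → ℂ))}
    {Ψ : (Fin n → ℂ) × (Fin n → ℂ) → ℂ} (hΨ : IsAlmostAnalyticExtension Ω Φ U Ψ)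
    {x : Fin n → ℂ} (hx : x ∈ Ω) {k N : ℕ} (hk : k ≤ N) (hN : IsNormalAt Φ x N) :
    scalarInvariant Φ Ψ k x = ∑ G : StableClass k, (G.coeff : ℂ) * G.weylValue Φ x := by
  obtain ⟨O, p, φ, ψ, ψ', z, z', hp, hφ, hψ, hψ', hz, hz', H⟩ := exists_normalJets hΦ hΨ hx hN
  have hJ := H.jetData hk
  set S := NormalJets.remainder (evalHom p) φ ψ ψ' z z'
  set t := NormalJets.tensor (dzD O) (dzBarD O) (evalHom p) φ
  rw [sum_stableClass_eq Φ x hN.metric_eq k t hJ.vanish]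
  swap
  · intro α β hα hβ
    rw [← hp, ← ((hφ.dzBarMulti β).dzMulti α).evalHom p]
    exact if_pos ⟨hα, hβ⟩
  simp only [sum_det_mul_contraction]
  rw [← hJ.sum_eval, scalarInvariant, englisR, hN.metric_eq, Matrix.det_one, div_one, one_mul]
  refine Finset.sum_congr rfl fun m _ => ?_
  congr 1
  -- It remains to identify the abstract remainder and determinant with the functions in `englisR`;
  -- the metric at `x` being the identity, the quadratic term is `∑ z_j z'_j`.
  have hS : Rep S (phaseRemainder Φ Ψ x) := by
    have h1 := (Rep.sum (s := Finset.univ) fun j _ => (hz j).mul (hz' j)).sub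
      ((((rep_const (evalHom p φ)).add hφ).sub hψ).sub hψ')
    intro r
    refine (h1 r).trans ?_
    rw [phaseRemainder, diastasis, hφ.evalHom, hp, hN.metric_eq]
    refine congrArg₂ (· - ·) (Finset.sum_congr rfl fun i _ => ?_) rfl
    rw [Finset.sum_eq_single i]
    · simp [coordFun, coordBarFun]
    · intro j _ hj
      simp [Matrix.one_apply_ne hj.symm]
    · simp
  have hdet : Rep (1 + Matrix.of fun i j => dzD O i (dzBarD O j φ) - if i = j then 1 else 0 :
      Matrix (Fin n) (Fin n) (smoothAlg O)).det
      fun y => (metric Φ y).det := by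
    refine Rep.det fun i j => ?_
    have h1 : (1 + Matrix.of fun i j => dzD O i (dzBarD O j φ) - if i = j then 1 else 0 :
        Matrix (Fin n) (Fin n) (smoothAlg O)) i j = dzD O i (dzBarD O j φ) := by
      rw [Matrix.add_apply, Matrix.of_apply, Matrix.one_apply, add_sub_cancel]
    rw [h1]
    exact (hφ.dzBarD j).dzD i
  have hF := (hdet.mul (hS.pow (m - k))).iterate
    (fun h => h.flatLaplacian hN.metric_eq) m
  rw [hF.evalHom, hp]
  simp only [one_mul]

end BerezinGraph

end

open BerezinGraph
theorem corollary3p7 {n : ℕ} (Ω : Set (Fin n → ℂ)) (Φ : (Fin n → ℂ) → ℝ)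
    (hΦ : IsKahlerPotential Ω Φ)
    (U : Set ((Fin n → ℂ) × (Fin n → ℂ))) (Ψ : (Fin n → ℂ) × (Fin n → ℂ) → ℂ)
    (hΨ : IsAlmostAnalyticExtension Ω Φ U Ψ) :
    (∀ x ∈ Ω, scalarInvariant Φ Ψ 0 x = 1) ∧
    ∀ k : ℕ, 1 ≤ k → ∀ N : ℕ, k ≤ N → ∀ x ∈ Ω, IsNormalAt Φ x N →
      scalarInvariant Φ Ψ k x =
        ∑ G : StableClass k, (G.coeff : ℂ) * G.weylValue Φ x :=
  ⟨fun _ hx => scalarInvariant_zero hΦ Ψ hx,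
    fun _ _ _ hk _ hx hN => scalarInvariant_eq_sum hΦ hΨ hx hk hN⟩
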